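/- Let $n\ge 0$. Identify a permutation $w\in S_n$ with its one-line notation $w_1w_2\cdots w_n$. **Box-ball system.** A state is an injective map from the balls $1,\dots,n$ to boxes labelled by the natural numbers. One BBS move lets each ball jump once, in the order $1,2,\dots,n$, to the nearest empty box to its right. The box-ball system containing $w$ starts from the state in which $w_1,\dots,w_n$ lie, in this order, in $n$ consecutive boxes. The increasing runs of a state are its maximal increasing strings of balls in consecutive boxes (read from left to right). A state is steady if its increasing runs are preserved by all subsequent BBS moves (they are then called solitons) and their sizes are weakly decreasing from right to left. The soliton decomposition $\mathrm{SD}(w)$ is the tableau obtained from a steady state of the box-ball system containing $w$ by stacking its solitons: the rightmost soliton is the first (top) row, the one to its left is the second row, and so on. **Knuth moves.** Let $x<y<z$. Two permutations differ by a $K_1$ move if one is $\cdots yxz\cdots$ and the other is $\cdots yzx\cdots$, and by a $K_2$ move if one is $\cdots xzy\cdots$ and the other is $\cdots zxy\cdots$ (all other entries agreeing). A Knuth move is a $K_1$ move or a $K_2$ move; it is a $K_B$ move if it is both, that is, if it exchanges $\cdots y_1xzy_2\cdots$ and $\cdots y_1zxy_2\cdots$ with $x<y_1<z$ and $x<y_2<z$.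 **Statement.** Let $w\in S_n$, let $T=P(w)$ be the Robinson–Schensted (row) insertion tableau of $w$, and let $r$ be the row reading word of $T$, that is, the concatenation of the rows of $T$ from bottom to top, each read from left to right. Then $\mathrm{SD}(w)$ exists and does not depend on the choice of the steady state, and: 1. if $w$ is related to $r$ by a finite sequence of Knuth moves containing an odd number of $K_B$ moves, then $\mathrm{SD}(w)\neq P(w)=T$; 2. if $w$ is related to $r$ by a finite (possibly empty) sequence of Knuth moves none of which is a $K_B$ move, then $\mathrm{SD}(w)=P(w)=T$. -/

import Mathlib

/-! Permutations of `{1, …, n}` are modelled by `Equiv.Perm (Fin n)`, the label `i : Fin n` standing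
for the integer `i + 1`. A word is a list. A tableau is the list of its rows, from top to bottom,
each row being the list of its entries from left to right. -/

section Tableaux

variable {α : Type*}

/-- The one-line notation of a permutation. -/
def oneLine {n : ℕ} (w : Equiv.Perm (Fin n)) : List (Fin n) :=
  List.ofFn w

/-- The row reading word of a tableau: its rows are concatenated from bottom to top, each row being
read from left to right. -/
def rowReadingWord (T : List (List α)) : List α :=
  T.reverse.flatten

variable [LinearOrder α]

/-- Insertion of `x` into an increasing row: `x` replaces the leftmost entry larger than `x`, which
is bumped (second component); if there is no such entry, `x` is put at the end of the row and
nothing is bumped. -/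
def rowInsert (x : α) : List α → List α × Option α
  | [] => ([x], none)
  | y :: ys =>
    if x < y then (x :: ys, some y)
    else (y :: (rowInsert x ys).1, (rowInsert x ys).2)

/-- Robinson–Schensted insertion of `x` into a tableau: `x` is inserted into the first row, the
entry bumped there (if any) into the second row, and so on. -/
def rsInsert (x : α) : List (List α) → List (List α)
  | [] => [[x]]
  | row :: rows =>
    match rowInsert x row with
    | (row', none) => row' :: rows
    | (row', some y) => row' :: rsInsert y rows

/-- The Robinson–Schensted insertion tableau of a word: its letters are inserted, from left to
right, into the empty tableau. -/
def insertionTableau (u : List α) : List (List α) :=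
  u.foldl (fun T x => rsInsert x T) []

end Tableaux

section KnuthMoves

variable {α : Type*} [LinearOrder α]

/-- The words `u` and `v` differ by a Knuth relation of the first kind (`K₁`):
`⋯ y x z ⋯` and `⋯ y z x ⋯`, or vice versa, with `x < y < z`. -/
def KnuthOne (u v : List α) : Prop :=
  ∃ (a b : List α) (x y z : α), x < y ∧ y < z ∧
    ((u = a ++ [y, x, z] ++ b ∧ v = a ++ [y, z, x] ++ b) ∨
      (v = a ++ [y, x, z] ++ b ∧ u = a ++ [y, z, x] ++ b))

/-- The words `u` and `v` differ by a Knuth relation of the second kind (`K₂`):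
`⋯ x z y ⋯` and `⋯ z x y ⋯`, or vice versa, with `x < y < z`. -/
def KnuthTwo (u v : List α) : Prop :=
  ∃ (a b : List α) (x y z : α), x < y ∧ y < z ∧
    ((u = a ++ [x, z, y] ++ b ∧ v = a ++ [z, x, y] ++ b) ∨
      (v = a ++ [x, z, y] ++ b ∧ u = a ++ [z, x, y] ++ b))

/-- A Knuth move is a move of the first or of the second kind. -/
def KnuthMove (u v : List α) : Prop :=
  KnuthOne u v ∨ KnuthTwo u v

/-- A `K_B` move is a move of both kinds. -/
def KnuthBoth (u v : List α) : Prop :=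
  KnuthOne u v ∧ KnuthTwo u v

/-- `KnuthPath k u v`: there is a finite (possibly empty) sequence of Knuth moves from `u` to `v`,
exactly `k` of which are `K_B` moves. -/
inductive KnuthPath : ℕ → List α → List α → Prop
  | refl (u : List α) : KnuthPath 0 u u
  | proper {k : ℕ} {u v v' : List α} :
      KnuthPath k u v → KnuthMove v v' → ¬ KnuthBoth v v' → KnuthPath k u v'
  | both {k : ℕ} {u v v' : List α} :
      KnuthPath k u v → KnuthBoth v v' → KnuthPath (k + 1) u v'

end KnuthMoves

section BoxBall

variable {n : ℕ}

/-- There is an empty box to the right of any box `p`, if ball `j` lies in box `s j`. -/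
theorem exists_emptyBox_right (s : Fin n → ℕ) (p : ℕ) : ∃ b, p < b ∧ ∀ j, s j ≠ b := by
  refine ⟨p + 1 + ∑ j, s j, by omega, fun j h => ?_⟩
  have := Finset.single_le_sum (f := s) (fun i _ => Nat.zero_le _) (Finset.mem_univ j)
  omega

/-- Ball `i` jumps to the nearest empty box to its right. A state of the box-ball system is
recorded as the function `s` that sends each ball to its box. -/
def moveBall (s : Fin n → ℕ) (i : Fin n) : Fin n → ℕ :=
  Function.update s i (Nat.find (exists_emptyBox_right s (s i)))

/-- One BBS move: every ball jumps once, in increasing order of the labels. -/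
def bbsMove (s : Fin n → ℕ) : Fin n → ℕ :=
  (List.finRange n).foldl moveBall s

/-- The state at time `0` given by `w`: the one-line notation of `w` fills the consecutive boxes
`0, 1, …, n - 1`, so that ball `w i` lies in box `i`. -/
def initialState (w : Equiv.Perm (Fin n)) : Fin n → ℕ :=
  fun b => (w.symm b : ℕ)

/-- The state at time `t` of the box-ball system containing `w`. -/
def bbsState (w : Equiv.Perm (Fin n)) (t : ℕ) : Fin n → ℕ :=
  bbsMove^[t] (initialState w)

/-- The balls in the order in which they lie in the boxes, from left to right. -/
def ballOrder (s : Fin n → ℕ) : List (Fin n) :=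
  (List.finRange n).insertionSort (fun i j => s i ≤ s j)

/-- The increasing runs of a state, that is, its maximal increasing strings of balls in consecutive
boxes, listed from the rightmost to the leftmost. -/
def increasingRuns (s : Fin n → ℕ) : List (List (Fin n)) :=
  ((ballOrder s).splitBy (fun i j => decide (s j = s i + 1 ∧ i < j))).reverse

/-- A state is steady if all its increasing runs are solitons, that is, they are preserved by all
subsequent BBS moves, and their sizes are weakly decreasing from right to left. -/
def IsSteadyState (s : Fin n → ℕ) : Prop :=
  (∀ t : ℕ, increasingRuns (bbsMove^[t] s) = increasingRuns s) ∧
    ((increasingRuns s).map List.length).Pairwise (· ≥ ·)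

/-- `S` is a soliton decomposition of `w`: it is obtained from a steady state of the box-ball system
containing `w` by stacking the solitons, the rightmost one being the first row, the one to its left
the second row, and so on. -/
def IsSolitonDecomposition (w : Equiv.Perm (Fin n)) (S : List (List (Fin n))) : Prop :=
  ∃ t : ℕ, IsSteadyState (bbsState w t) ∧ S = increasingRuns (bbsState w t)

end BoxBall

/-! Read a state as a sequence of letters in which an empty box exceeds every ball. A descent then
sits just before each increasing run, so descents mark the left ends of the runs. If every ball that
has jumped is relabelled above all the other balls, each jump takes the smallest letter to the next
empty box and makes it the largest ball. Its only effect on the descent set is to move one descent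
one step to the right (`IsJump.isHop`). Hence the number of runs is conserved, and the index of the
run containing a given ball, counted from the right, never increases. The indices stabilise
(`exists_isLimitIndex`); from then on each run advances by its size in every move, and since the
runs keep their order the sizes weakly decrease from right to left
(`IsLimitIndex.rowSize_antitone`). So a steady state exists. Its runs are unique because any two
steady states share a later state.

A Knuth move that is not `K_B` persists under every jump (`IsProperSwap.jump`), once exchanges of a
ball with an empty box are allowed as well. At all times the two descent sets therefore differ by
one hop and the run indices differ at one ball at most. Bounded distance forces equal speeds, hence
equal run sizes, and then equal limits (`ProperlyAdjacent.isLimitIndex_eq`).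

The row reading word of a tableau is steady from the start: strict columns prevent a ball from
joining the next run (`isLimitIndex_of_columnStrict`). This gives part 2. For part 1, the number of
runs is kept by moves that are not `K_B` and changes by one under `K_B` moves, so after an odd
number of these it cannot equal the number of rows of `T`. About `T` the argument needs only that it
is a tableau with the entries of `w`. -/

/-! ### Counting the elements of a set of natural numbers from the right -/

section TailCount

/-- The number of elements of `D` that are at least `x`. -/
noncomputable def tailCount (D : Set ℕ) (x : ℕ) : ℕ := (D ∩ Set.Ici x).ncard

/-- The number of `x` such that more than `k` elements of `D` are at least `x`. -/
noncomputable def levelCount (D : Set ℕ) (k : ℕ) : ℕ := {x | k < tailCount D x}.ncard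

variable {D D' : Set ℕ}

theorem tailCount_of_mem (hD : D.Finite) {x : ℕ} (hx : x ∈ D) :
    tailCount D x = tailCount D (x + 1) + 1 := by
  have : D ∩ Set.Ici x = insert x (D ∩ Set.Ici (x + 1)) := by
    ext y
    simp only [Set.mem_inter_iff, Set.mem_Ici, Set.mem_insert_iff]
    constructor
    · rintro ⟨h1, h2⟩
      rcases h2.eq_or_lt with h | h
      · exact Or.inl h.symm
      · exact Or.inr ⟨h1, h⟩
    · rintro (rfl | ⟨h1, h2⟩)
      · exact ⟨hx, le_rfl⟩
      · exact ⟨h1, by omega⟩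
  rw [tailCount, this, Set.ncard_insert_of_notMem (by simp) (hD.inter_of_left _), tailCount]

theorem tailCount_of_notMem {x : ℕ} (hx : x ∉ D) : tailCount D x = tailCount D (x + 1) := by
  have : D ∩ Set.Ici x = D ∩ Set.Ici (x + 1) := by
    ext y
    simp only [Set.mem_inter_iff, Set.mem_Ici]
    refine and_congr_right fun h => ⟨fun h2 => ?_, fun h2 => by omega⟩
    have : x ≠ y := by rintro rfl; exact hx h
    omega
  rw [tailCount, this, tailCount]

theorem tailCount_antitone (hD : D.Finite) : Antitone (tailCount D) := by
  refine antitone_nat_of_succ_le fun x => ?_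
  by_cases hx : x ∈ D
  · rw [tailCount_of_mem hD hx]; omega
  · rw [tailCount_of_notMem hx]

theorem tailCount_eq_of_forall_notMem {x y : ℕ} (hxy : x ≤ y)
    (h : ∀ z, x ≤ z → z < y → z ∉ D) : tailCount D x = tailCount D y := by
  induction y, hxy using Nat.le_induction with
  | base => rfl
  | succ y hxy ih =>
    rw [ih fun z h1 h2 => h z h1 (by omega), tailCount_of_notMem (h y hxy (by omega))]

theorem tailCount_eq_zero {x : ℕ} (h : ∀ z, x ≤ z → z ∉ D) : tailCount D x = 0 := by
  have : D ∩ Set.Ici x = ∅ := by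
    ext y
    simp only [Set.mem_inter_iff, Set.mem_Ici, Set.mem_empty_iff_false, iff_false, not_and]
    exact fun h1 h2 => h y h2 h1
  rw [tailCount, this, Set.ncard_empty]

theorem finite_setOf_lt_tailCount (hD : D.Finite) (k : ℕ) : {x | k < tailCount D x}.Finite := by
  obtain ⟨N, hN⟩ := hD.bddAbove
  refine (Set.finite_Iic N).subset fun x hx => ?_
  by_contra hlt
  simp only [Set.mem_Iic, not_le] at hlt
  have : tailCount D x = 0 := tailCount_eq_zero fun z hz hzD => by
    have := hN hzD
    omega
  simp only [Set.mem_ofPred_eq] at hx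
  omega

theorem levelCount_antitone (hD : D.Finite) : Antitone (levelCount D) := fun i j hij =>
  Set.ncard_le_ncard (fun x (hx : j < _) => show i < _ by omega) (finite_setOf_lt_tailCount hD i)

/-- Each level set is an initial segment of the naturals, ending at the element of `D` with exactly
`k` elements of `D` beyond it, if there is one. Level counts thus record positions, and their
differences are the gaps between neighbouring elements. -/
theorem levelCount_eq_add (hD : D.Finite) (k : ℕ) :
    levelCount D k = levelCount D (k + 1) + {x | tailCount D x = k + 1}.ncard := by
  have : {x | k < tailCount D x} = {x | k + 1 < tailCount D x} ∪ {x | tailCount D x = k + 1} := by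
    ext x
    simp only [Set.mem_ofPred_eq, Set.mem_union]
    omega
  have hdisj : Disjoint {x | k + 1 < tailCount D x} {x | tailCount D x = k + 1} := by
    rw [Set.disjoint_left]
    intro x hx hx'
    simp only [Set.mem_ofPred_eq] at hx hx'
    omega
  have hfin : {x | tailCount D x = k + 1}.Finite :=
    (finite_setOf_lt_tailCount hD k).subset fun x hx => by
      simp only [Set.mem_ofPred_eq] at hx ⊢
      omega
  rw [levelCount, this, Set.ncard_union_eq hdisj (finite_setOf_lt_tailCount hD _) hfin, levelCount]

/-- `D'` is obtained from `D` by replacing the element `u` by `u + 1`. -/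
structure IsHop (D D' : Set ℕ) (u : ℕ) : Prop where
  mem : u ∈ D
  succ_notMem : u + 1 ∉ D
  notMem' : u ∉ D'
  succ_mem' : u + 1 ∈ D'
  iff : ∀ y, y ≠ u → y ≠ u + 1 → (y ∈ D' ↔ y ∈ D)

theorem tailCount_congr {x : ℕ} (h : ∀ y, x ≤ y → (y ∈ D' ↔ y ∈ D)) :
    tailCount D' x = tailCount D x := by
  have : D' ∩ Set.Ici x = D ∩ Set.Ici x := by
    ext y
    simp only [Set.mem_inter_iff, Set.mem_Ici]
    constructor
    · rintro ⟨h1, h2⟩; exact ⟨(h y h2).1 h1, h2⟩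
    · rintro ⟨h1, h2⟩; exact ⟨(h y h2).2 h1, h2⟩
  rw [tailCount, this, tailCount]

/-- Going left through a region where the two sets agree, both counts grow together. The two
summands `a` and `b` express a signed difference without subtraction. -/
theorem tailCount_add_congr (hD : D.Finite) (hD' : D'.Finite) {x : ℕ} {a b : ℕ}
    (h : tailCount D' x + a = tailCount D x + b) (hlt : ∀ y, y < x → (y ∈ D' ↔ y ∈ D)) {z : ℕ}
    (hz : z ≤ x) : tailCount D' z + a = tailCount D z + b := by
  induction x, hz using Nat.le_induction with
  | base => exact h
  | succ x hzx ih =>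
    refine ih ?_ fun y hy => hlt y (by omega)
    have hx := hlt x (by omega)
    by_cases hxD : x ∈ D
    · rw [tailCount_of_mem hD hxD, tailCount_of_mem hD' (hx.2 hxD)]; omega
    · rw [tailCount_of_notMem hxD, tailCount_of_notMem (fun h' => hxD (hx.1 h'))]; omega

theorem IsHop.tailCount_succ {u : ℕ} (h : IsHop D D' u) (hD' : D'.Finite) :
    tailCount D' (u + 1) = tailCount D (u + 1) + 1 := by
  rw [tailCount_of_mem hD' h.succ_mem', tailCount_of_notMem h.succ_notMem,
    tailCount_congr fun y hy => h.iff y (by omega) (by omega)]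

theorem IsHop.tailCount_eq {u : ℕ} (h : IsHop D D' u) (hD : D.Finite) (hD' : D'.Finite) {x : ℕ}
    (hx : x ≠ u + 1) : tailCount D' x = tailCount D x := by
  rcases lt_or_ge (u + 1) x with h1 | h1
  · exact tailCount_congr fun y hy => h.iff y (by omega) (by omega)
  · refine tailCount_add_congr hD hD' (x := u) (a := 0) (b := 0) ?_
      (fun y hy => h.iff y (by omega) (by omega)) (by omega)
    rw [tailCount_of_notMem h.notMem', h.tailCount_succ hD', tailCount_of_mem hD h.mem]

/-- A hop changes the tail count at `u + 1` only, raising it by one, so that point enters exactly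
one level set. -/
theorem IsHop.levelCount_eq {u : ℕ} (h : IsHop D D' u) (hD : D.Finite) (hD' : D'.Finite) (k : ℕ) :
    levelCount D' k = levelCount D k + if tailCount D (u + 1) = k then 1 else 0 := by
  have h1 := h.tailCount_succ hD'
  split_ifs with hk
  · have : {x | k < tailCount D' x} = insert (u + 1) {x | k < tailCount D x} := by
      ext x
      simp only [Set.mem_ofPred_eq, Set.mem_insert_iff]
      by_cases hx : x = u + 1
      · subst hx; simp; omega
      · rw [h.tailCount_eq hD hD' hx]; simp [hx]
    rw [levelCount, this, Set.ncard_insert_of_notMem (by simp; omega)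
      (finite_setOf_lt_tailCount hD k), levelCount]
  · have : {x | k < tailCount D' x} = {x | k < tailCount D x} := by
      ext x
      simp only [Set.mem_ofPred_eq]
      by_cases hx : x = u + 1
      · subst hx; omega
      · rw [h.tailCount_eq hD hD' hx]
    rw [levelCount, this, levelCount, add_zero]

/-- The set of descents of a sequence. -/
def descentSet (X : ℕ → ℕ) : Set ℕ := {y | X (y + 1) < X y}

theorem mem_descentSet {X : ℕ → ℕ} {y : ℕ} : y ∈ descentSet X ↔ X (y + 1) < X y := Iff.rfl

end TailCount

/-! ### Labelled configurations -/

section Config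

variable {n : ℕ}

/-- The label of ball `j` when the balls smaller than `i` have already jumped: these are
relabelled so as to be larger than all the others, but smaller than an empty box, whose label
is `2 * n`. -/
def ballLabel (n i j : ℕ) : ℕ := if j < i then j + n else j

open Classical in
/-- The sequence of labels of a state, the box `b` being at position `b + 1`, when the balls
smaller than `i` have already jumped. -/
noncomputable def config (i : ℕ) (s : Fin n → ℕ) (x : ℕ) : ℕ :=
  if h : ∃ j, s j + 1 = x then ballLabel n i h.choose else 2 * n

/-- The index, counted from the right and starting from `0`, of the increasing run of the labelled
configuration `config i s` that contains ball `j`. -/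
noncomputable def runIndex (i : ℕ) (s : Fin n → ℕ) (j : Fin n) : ℕ :=
  tailCount (descentSet (config i s)) (s j + 1)

theorem ballLabel_lt {i : ℕ} (j : Fin n) : ballLabel n i j < 2 * n := by
  unfold ballLabel
  split_ifs <;> omega

theorem ballLabel_inj {i : ℕ} {j k : Fin n} (h : ballLabel n i j = ballLabel n i k) : j = k := by
  unfold ballLabel at h
  ext
  split_ifs at h <;> omega

theorem config_ball {i : ℕ} {s : Fin n → ℕ} (hs : Function.Injective s) (j : Fin n) :
    config i s (s j + 1) = ballLabel n i j := by
  have h : ∃ k, s k + 1 = s j + 1 := ⟨j, rfl⟩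
  rw [config, dif_pos h]
  have := h.choose_spec
  rw [hs (Nat.succ_injective this)]

theorem config_of_forall_ne {i : ℕ} {s : Fin n → ℕ} {x : ℕ} (h : ∀ j, s j + 1 ≠ x) :
    config i s x = 2 * n := by
  rw [config, dif_neg (by simpa using h)]

/-- The shift by one leaves an empty position before box `0`, so that a run starting in box `0` is
also preceded by a descent. -/
theorem config_zero {i : ℕ} {s : Fin n → ℕ} : config i s 0 = 2 * n :=
  config_of_forall_ne fun _ => by omega

theorem config_cases {i : ℕ} {s : Fin n → ℕ} (hs : Function.Injective s) (x : ℕ) :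
    (∃ j, s j + 1 = x ∧ config i s x = ballLabel n i j) ∨
      ((∀ j, s j + 1 ≠ x) ∧ config i s x = 2 * n) := by
  by_cases h : ∃ j, s j + 1 = x
  · obtain ⟨j, rfl⟩ := h
    exact Or.inl ⟨j, rfl, config_ball hs j⟩
  · push Not at h
    exact Or.inr ⟨h, config_of_forall_ne h⟩

theorem config_le {i : ℕ} {s : Fin n → ℕ} (hs : Function.Injective s) (x : ℕ) :
    config i s x ≤ 2 * n := by
  rcases config_cases (i := i) hs x with ⟨j, -, h⟩ | ⟨-, h⟩
  · rw [h]; exact (ballLabel_lt j).le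
  · exact h.le

theorem config_eq_ballLabel_iff {i : ℕ} {s : Fin n → ℕ} (hs : Function.Injective s) {x : ℕ}
    {j : Fin n} : config i s x = ballLabel n i j ↔ s j + 1 = x := by
  constructor
  · intro h
    rcases config_cases (i := i) hs x with ⟨k, hk, h'⟩ | ⟨-, h'⟩
    · rw [h'] at h
      rw [← ballLabel_inj h, hk]
    · have := ballLabel_lt (i := i) j
      omega
  · rintro rfl
    exact config_ball hs j

theorem config_lt_iff {i : ℕ} {s : Fin n → ℕ} (hs : Function.Injective s) {x : ℕ} :
    config i s x < 2 * n ↔ ∃ j, s j + 1 = x := by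
  constructor
  · intro h
    rcases config_cases (i := i) hs x with ⟨k, hk, h'⟩ | ⟨-, h'⟩
    · exact ⟨k, hk⟩
    · omega
  · rintro ⟨j, rfl⟩
    rw [config_ball hs]
    exact ballLabel_lt j

theorem finite_descentSet_config {i : ℕ} {s : Fin n → ℕ} (hs : Function.Injective s) :
    (descentSet (config i s)).Finite := by
  refine ((Set.finite_range fun j => s j).subset fun y hy => ?_)
  rw [mem_descentSet] at hy
  obtain ⟨j, hj⟩ := (config_lt_iff hs).1 (hy.trans_le (config_le hs y))
  exact ⟨j, by simpa using hj⟩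

theorem config_self_eq {s : Fin n → ℕ} (hs : Function.Injective s) (x : ℕ) :
    (config 0 s x = 2 * n ∧ config n s x = 2 * n) ∨
      (config 0 s x < n ∧ config n s x = config 0 s x + n) := by
  rcases config_cases (i := 0) hs x with ⟨j, rfl, -⟩ | ⟨h, h'⟩
  · right
    rw [config_ball hs, config_ball hs]
    simp [ballLabel]
  · exact Or.inl ⟨h', config_of_forall_ne h⟩

/-- Once all balls are relabelled, their order among themselves and below the empty boxes is the
original one, so the labels can be reset for the next move. -/
theorem descentSet_config_self (s : Fin n → ℕ) (hs : Function.Injective s) :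
    descentSet (config n s) = descentSet (config 0 s) := by
  ext y
  rw [mem_descentSet, mem_descentSet]
  have h1 := config_self_eq hs y
  have h2 := config_self_eq hs (y + 1)
  omega

/-! ### The jump of a ball -/

/-- The sequence `X'` is obtained from `X` when the letter at position `p`, which is the smallest
letter of `X`, jumps to position `q`, where it becomes `M`, the largest letter other than `E`. -/
structure IsJump (E m M : ℕ) (X X' : ℕ → ℕ) (p q : ℕ) : Prop where
  pos : 0 < p
  lt : p < q
  apply_left : X p = m
  apply_right : X q = E
  lt_of_between : ∀ x, p < x → x < q → X x < E
  apply_left' : X' p = E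
  apply_right' : X' q = M
  apply_of_ne : ∀ x, x ≠ p → x ≠ q → X' x = X x
  lt_of_ne : ∀ x, x ≠ p → m < X x
  lt_top : M < E
  le_top : ∀ x, X x ≤ E
  lt_of_lt_top : ∀ x, X x < E → X x < M

/-- The smallest letter always has a descent before it and none after it; the empty box it leaves
behind has the opposite pattern. At the landing place nothing changes, since `M` compares with the
other letters below `E` just as `E` does. -/
theorem IsJump.isHop {E m M p q : ℕ} {X X' : ℕ → ℕ} (h : IsJump E m M X X' p q) :
    IsHop (descentSet X) (descentSet X') (p - 1) := by
  obtain ⟨hpos, hlt, h1, h2, h3, h4, h5, h6, h7, h8, h9, h10⟩ := h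
  obtain ⟨p, rfl⟩ : ∃ p', p = p' + 1 := ⟨p - 1, by omega⟩
  simp only [Nat.add_sub_cancel]
  have hle : ∀ x, X' x ≤ E := fun x => by
    by_cases hp : x = p + 1
    · rw [hp, h4]
    · by_cases hq : x = q
      · rw [hq, h5]; exact h8.le
      · rw [h6 x hp hq]; exact h9 x
  refine ⟨?_, ?_, ?_, ?_, fun y hy1 hy2 => ?_⟩
  · rw [mem_descentSet, h1]; exact h7 p (by omega)
  · rw [mem_descentSet, h1, not_lt]; exact (h7 _ (by omega)).le
  · rw [mem_descentSet, h4, not_lt]; exact hle p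
  · rw [mem_descentSet, h4]
    by_cases hq : p + 1 + 1 = q
    · rw [hq, h5]; exact h8
    · rw [h6 _ (by omega) hq]; exact h3 _ (by omega) (by omega)
  · rw [mem_descentSet, mem_descentSet]
    by_cases hq : y = q
    · subst hq
      rw [h5, h2, h6 (y + 1) (by omega) (by omega)]
      exact ⟨fun h => h.trans h8, h10 _⟩
    · by_cases hq' : y + 1 = q
      · rw [hq', h5, h2, h6 y (by omega) (by omega)]
        have := h10 y (h3 y (by omega) (by omega))
        have := h9 y
        omega
      · rw [h6 y (by omega) (by omega), h6 (y + 1) (by omega) (by omega)]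

theorem moveBall_apply_self (s : Fin n → ℕ) (i : Fin n) :
    s i < moveBall s i i ∧ (∀ j, s j ≠ moveBall s i i) ∧
      ∀ x, s i < x → x < moveBall s i i → ∃ j, s j = x := by
  simp only [moveBall, Function.update_self]
  refine ⟨(Nat.find_spec (exists_emptyBox_right s (s i))).1,
    (Nat.find_spec (exists_emptyBox_right s (s i))).2, fun x h1 h2 => ?_⟩
  have := Nat.find_min (exists_emptyBox_right s (s i)) h2
  push Not at this
  exact this h1

theorem moveBall_apply_of_ne (s : Fin n → ℕ) {i j : Fin n} (h : j ≠ i) : moveBall s i j = s j := by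
  simp [moveBall, Function.update_of_ne h]

theorem moveBall_injective {s : Fin n → ℕ} (hs : Function.Injective s) (i : Fin n) :
    Function.Injective (moveBall s i) := by
  have h := (moveBall_apply_self s i).2.1
  intro j k hjk
  by_cases hj : j = i
  · by_cases hk : k = i
    · rw [hj, hk]
    · rw [hj, moveBall_apply_of_ne s hk] at hjk
      exact absurd hjk.symm (h k)
  · by_cases hk : k = i
    · rw [hk, moveBall_apply_of_ne s hj] at hjk
      exact absurd hjk (h j)
    · rw [moveBall_apply_of_ne s hj, moveBall_apply_of_ne s hk] at hjk
      exact hs hjk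

theorem isJump_moveBall {s : Fin n → ℕ} (hs : Function.Injective s) (i : Fin n) :
    IsJump (2 * n) i (i + n) (config i s) (config (i + 1) (moveBall s i)) (s i + 1)
      (moveBall s i i + 1) := by
  obtain ⟨h1, h2, h3⟩ := moveBall_apply_self s i
  have hs' := moveBall_injective hs i
  have hlab : ∀ j : Fin n, j ≠ i → ballLabel n (i + 1) j = ballLabel n i j := fun j hj => by
    have : (j : ℕ) ≠ i := fun h => hj (Fin.ext h)
    unfold ballLabel
    split_ifs <;> omega
  have hi := i.isLt
  refine ⟨by omega, by omega, ?_, ?_, ?_, ?_, ?_, ?_, ?_, by omega, config_le hs, ?_⟩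
  · rw [config_ball hs]; simp [ballLabel]
  · exact config_of_forall_ne fun j => by have := h2 j; omega
  · intro x hx1 hx2
    obtain ⟨j, hj⟩ := h3 (x - 1) (by omega) (by omega)
    exact (config_lt_iff hs).2 ⟨j, by omega⟩
  · refine config_of_forall_ne fun j => ?_
    by_cases hj : j = i
    · rw [hj]; omega
    · rw [moveBall_apply_of_ne s hj]
      intro h
      exact hj (hs (by omega))
  · rw [config_ball hs']; simp [ballLabel]
  · intro x hx1 hx2
    rcases config_cases (i := i) hs x with ⟨j, rfl, h⟩ | ⟨h, h'⟩
    · have hj : j ≠ i := by rintro rfl; exact hx1 rfl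
      rw [h, ← hlab j hj, ← moveBall_apply_of_ne s hj, config_ball hs']
    · rw [h', config_of_forall_ne fun j => ?_]
      by_cases hj : j = i
      · rw [hj]; omega
      · rw [moveBall_apply_of_ne s hj]; exact h j
  · intro x hx
    rcases config_cases (i := i) hs x with ⟨j, rfl, h⟩ | ⟨-, h'⟩
    · have hj : (j : ℕ) ≠ i := fun h => hx (by rw [Fin.ext h])
      rw [h, ballLabel]
      split_ifs <;> omega
    · omega
  · intro x hx
    obtain ⟨j, rfl⟩ := (config_lt_iff hs).1 hx
    rw [config_ball hs, ballLabel]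
    split_ifs <;> omega

/-- The number of balls whose value under `f` is `k`. -/
def rowSize (f : Fin n → ℕ) (k : ℕ) : ℕ := (Finset.univ.filter fun j => f j = k).card

/-- The hop alters the tail count only at the position which the jumping ball leaves, and no other
ball is there. -/
theorem runIndex_moveBall_of_ne {s : Fin n → ℕ} (hs : Function.Injective s) {i j : Fin n}
    (hj : j ≠ i) : runIndex (i + 1) (moveBall s i) j = runIndex i s j := by
  have h := (isJump_moveBall hs i).isHop
  rw [runIndex, runIndex, moveBall_apply_of_ne s hj]
  refine h.tailCount_eq (finite_descentSet_config hs)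
    (finite_descentSet_config (moveBall_injective hs i)) ?_
  have : s j ≠ s i := fun h => hj (hs h)
  omega

theorem runIndex_moveBall_self {s : Fin n → ℕ} (hs : Function.Injective s) (i : Fin n) :
    runIndex (i + 1) (moveBall s i) i =
      tailCount (descentSet (config i s)) (moveBall s i i + 1) := by
  have h := (isJump_moveBall hs i).isHop
  have := (moveBall_apply_self s i).1
  rw [runIndex]
  exact h.tailCount_eq (finite_descentSet_config hs)
    (finite_descentSet_config (moveBall_injective hs i)) (by omega)

theorem runIndex_moveBall_le {s : Fin n → ℕ} (hs : Function.Injective s) (i j : Fin n) :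
    runIndex (i + 1) (moveBall s i) j ≤ runIndex i s j := by
  by_cases hj : j = i
  · subst hj
    rw [runIndex_moveBall_self hs, runIndex]
    have := (moveBall_apply_self s j).1
    exact tailCount_antitone (finite_descentSet_config hs) (by omega)
  · exact (runIndex_moveBall_of_ne hs hj).le

theorem levelCount_moveBall {s : Fin n → ℕ} (hs : Function.Injective s) (i : Fin n) (k : ℕ) :
    levelCount (descentSet (config (i + 1) (moveBall s i))) k =
      levelCount (descentSet (config i s)) k + if runIndex i s i = k then 1 else 0 := by
  have h := (isJump_moveBall hs i).isHop
  rw [h.levelCount_eq (finite_descentSet_config hs)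
    (finite_descentSet_config (moveBall_injective hs i))]
  rfl

theorem tailCount_zero_moveBall {s : Fin n → ℕ} (hs : Function.Injective s) (i : Fin n) :
    tailCount (descentSet (config (i + 1) (moveBall s i))) 0 =
      tailCount (descentSet (config i s)) 0 :=
  (isJump_moveBall hs i).isHop.tailCount_eq (finite_descentSet_config hs)
    (finite_descentSet_config (moveBall_injective hs i)) (by omega)

/-- A ball changes run only by jumping past the next descent. The positions of its tail count then
all lie from its own position up to its landing place, so they are all occupied. -/
theorem ncard_tailCount_eq_of_moveBall_ne {s : Fin n → ℕ} (hs : Function.Injective s) (i : Fin n)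
    (h : runIndex (i + 1) (moveBall s i) i ≠ runIndex i s i) :
    {x | tailCount (descentSet (config i s)) x = runIndex i s i}.ncard ≤
      rowSize (runIndex i s) (runIndex i s i) := by
  have hD := finite_descentSet_config (i := i) hs
  have hlt := lt_of_le_of_ne (runIndex_moveBall_le hs i i) h
  rw [runIndex_moveBall_self hs] at hlt
  have hJ := isJump_moveBall hs i
  have hsub : {x | tailCount (descentSet (config i s)) x = runIndex i s i} ⊆
      ((Finset.univ.filter fun j => runIndex i s j = runIndex i s i).image
        fun j => s j + 1 : Finset ℕ) := by
    intro x hx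
    simp only [Set.mem_ofPred_eq] at hx
    have h1 : s i + 1 ≤ x := by
      by_contra hcon
      have h2 := tailCount_of_mem hD hJ.isHop.mem
      have h3 := tailCount_antitone hD (show x ≤ s i + 1 - 1 by omega)
      simp only [Nat.add_sub_cancel] at h2 h3
      rw [runIndex] at hx
      omega
    have h2 : x < moveBall s i i + 1 := by
      by_contra hcon
      have h3 := tailCount_antitone hD (show moveBall s i i + 1 ≤ x by omega)
      omega
    have h4 : config i s x < 2 * n := by
      rcases h1.eq_or_lt with h1 | h1
      · rw [← h1, config_ball hs]
        exact ballLabel_lt i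
      · exact hJ.lt_of_between x h1 h2
    obtain ⟨j, rfl⟩ := (config_lt_iff hs).1 h4
    simp only [Finset.coe_image, Set.mem_image, Finset.mem_coe, Finset.mem_filter,
      Finset.mem_univ, true_and]
    exact ⟨j, hx, rfl⟩
  refine (Set.ncard_le_ncard hsub (Finset.finite_toSet _)).trans ?_
  rw [Set.ncard_coe_finset]
  exact Finset.card_image_le

end Config

/-! ### The evolution of the increasing runs -/

section Evolution

variable {n : ℕ}

/-- The state after the balls smaller than `i` have jumped. -/
def partialMove (s : Fin n → ℕ) : ℕ → Fin n → ℕ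
  | 0 => s
  | i + 1 => if h : i < n then moveBall (partialMove s i) ⟨i, h⟩ else partialMove s i

theorem partialMove_succ (s : Fin n → ℕ) (i : Fin n) :
    partialMove s (i + 1) = moveBall (partialMove s i) i := by
  rw [partialMove, dif_pos i.isLt]

theorem bbsMove_eq_partialMove (s : Fin n → ℕ) : bbsMove s = partialMove s n := by
  have key : ∀ i, i ≤ n → ((List.finRange n).take i).foldl moveBall s = partialMove s i := by
    intro i
    induction i with
    | zero => intro _; simp [partialMove]
    | succ i ih =>
      intro hi
      have hi' : i < (List.finRange n).length := by simpa using hi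
      rw [← List.take_append_getElem hi', List.foldl_append, ih (by omega)]
      simp [partialMove, Nat.lt_of_succ_le hi]
  have := key n le_rfl
  rwa [List.take_of_length_le (by simp)] at this

theorem partialMove_injective {s : Fin n → ℕ} (hs : Function.Injective s) (i : ℕ) :
    Function.Injective (partialMove s i) := by
  induction i with
  | zero => exact hs
  | succ i ih =>
    rw [partialMove]
    split_ifs with h
    · exact moveBall_injective ih _
    · exact ih

theorem bbsMove_injective {s : Fin n → ℕ} (hs : Function.Injective s) :
    Function.Injective (bbsMove s) := by
  rw [bbsMove_eq_partialMove]
  exact partialMove_injective hs n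

theorem bbsMove_iterate_injective {s : Fin n → ℕ} (hs : Function.Injective s) (t : ℕ) :
    Function.Injective (bbsMove^[t] s) := by
  induction t with
  | zero => exact hs
  | succ t ih => rw [Function.iterate_succ_apply']; exact bbsMove_injective ih

theorem runIndex_partialMove_antitone {s : Fin n → ℕ} (hs : Function.Injective s) (j : Fin n)
    {i k : ℕ} (hik : i ≤ k) (hk : k ≤ n) :
    runIndex k (partialMove s k) j ≤ runIndex i (partialMove s i) j := by
  induction k, hik using Nat.le_induction with
  | base => exact le_rfl
  | succ k hik ih =>
    refine le_trans ?_ (ih (by omega))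
    have := runIndex_moveBall_le (partialMove_injective hs k) ⟨k, hk⟩ j
    rwa [← partialMove_succ s ⟨k, hk⟩] at this

theorem runIndex_partialMove_self {s : Fin n → ℕ} (hs : Function.Injective s) :
    runIndex n (partialMove s n) = runIndex 0 (bbsMove s) := by
  ext j
  rw [runIndex, descentSet_config_self _ (partialMove_injective hs n), bbsMove_eq_partialMove,
    runIndex]

theorem runIndex_bbsMove_le {s : Fin n → ℕ} (hs : Function.Injective s) :
    runIndex 0 (bbsMove s) ≤ runIndex 0 s := by
  intro j
  rw [← runIndex_partialMove_self hs]
  exact runIndex_partialMove_antitone hs j (Nat.zero_le n) le_rfl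

/-- Each jump advances the left end of the run that the ball leaves, so the displacement of an end
counts the jumps made so far from that run. -/
theorem levelCount_partialMove {s : Fin n → ℕ} (hs : Function.Injective s) (f : Fin n → ℕ) {i : ℕ}
    (hi : i ≤ n) (hf : ∀ j : Fin n, (j : ℕ) < i → runIndex j (partialMove s j) j = f j) (k : ℕ) :
    levelCount (descentSet (config i (partialMove s i))) k =
      levelCount (descentSet (config 0 s)) k +
        (Finset.univ.filter fun j : Fin n => f j = k ∧ (j : ℕ) < i).card := by
  induction i with
  | zero => simp [partialMove]
  | succ i ih =>
    have h := levelCount_moveBall (partialMove_injective hs i) ⟨i, hi⟩ k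
    rw [← partialMove_succ s ⟨i, hi⟩] at h
    change levelCount (descentSet (config (i + 1) (partialMove s (i + 1)))) k =
      levelCount (descentSet (config i (partialMove s i))) k +
        if runIndex i (partialMove s i) ⟨i, hi⟩ = k then 1 else 0 at h
    rw [h, ih (by omega) fun j hj => hf j (by omega), hf ⟨i, hi⟩ (by simp), add_assoc]
    congr 1
    split_ifs with hk
    · rw [← Finset.card_insert_of_notMem (a := (⟨i, hi⟩ : Fin n)) (by simp)]
      congr 1
      ext j
      simp only [Finset.mem_insert, Finset.mem_filter, Finset.mem_univ, true_and, Fin.ext_iff]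
      constructor
      · rintro (h | ⟨h1, h2⟩)
        · have : j = ⟨i, hi⟩ := Fin.ext h
          rw [this]
          exact ⟨hk, by simp⟩
        · exact ⟨h1, by omega⟩
      · rintro ⟨h1, h2⟩
        by_cases h3 : (j : ℕ) = i
        · exact Or.inl h3
        · exact Or.inr ⟨h1, by omega⟩
    · rw [add_zero]
      congr 1
      ext j
      simp only [Finset.mem_filter, Finset.mem_univ, true_and]
      refine and_congr_right fun h1 => ⟨fun h2 => by omega, fun h2 => ?_⟩
      have : (j : ℕ) ≠ i := by
        intro h3
        have : j = ⟨i, hi⟩ := Fin.ext h3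
        rw [this] at h1
        exact hk h1
      omega

theorem levelCount_bbsMove {s : Fin n → ℕ} (hs : Function.Injective s)
    (h : runIndex 0 (bbsMove s) = runIndex 0 s) (k : ℕ) :
    levelCount (descentSet (config 0 (bbsMove s))) k =
      levelCount (descentSet (config 0 s)) k + rowSize (runIndex 0 s) k := by
  have h1 := levelCount_partialMove hs (runIndex 0 s) le_rfl (fun j _ => ?_) k
  · rw [descentSet_config_self _ (partialMove_injective hs n), ← bbsMove_eq_partialMove] at h1
    rw [h1, rowSize]
    simp
  -- Indices only fall during a move; equality between its start and its end fixes all intermediate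
  -- values.
  · refine le_antisymm (runIndex_partialMove_antitone hs j (Nat.zero_le j) j.isLt.le) ?_
    rw [← h, ← runIndex_partialMove_self hs]
    exact runIndex_partialMove_antitone hs j j.isLt.le le_rfl

theorem tailCount_zero_bbsMove {s : Fin n → ℕ} (hs : Function.Injective s) :
    tailCount (descentSet (config 0 (bbsMove s))) 0 = tailCount (descentSet (config 0 s)) 0 := by
  have key : ∀ i, i ≤ n → tailCount (descentSet (config i (partialMove s i))) 0 =
      tailCount (descentSet (config 0 s)) 0 := by
    intro i
    induction i with
    | zero => intro _; rfl
    | succ i ih =>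
      intro hi
      rw [← ih (by omega), ← tailCount_zero_moveBall (partialMove_injective hs i) ⟨i, hi⟩,
        ← partialMove_succ s ⟨i, hi⟩]
  rw [← key n le_rfl, descentSet_config_self _ (partialMove_injective hs n), bbsMove_eq_partialMove]

theorem tailCount_zero_bbsMove_iterate {s : Fin n → ℕ} (hs : Function.Injective s) (t : ℕ) :
    tailCount (descentSet (config 0 (bbsMove^[t] s))) 0 =
      tailCount (descentSet (config 0 s)) 0 := by
  induction t with
  | zero => rfl
  | succ t ih =>
    rw [Function.iterate_succ_apply', tailCount_zero_bbsMove (bbsMove_iterate_injective hs t), ih]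

/-- From the time `T` on, the increasing runs of the box-ball system starting from `s` are the
fibres of `f`. -/
def IsLimitIndex (s : Fin n → ℕ) (f : Fin n → ℕ) (T : ℕ) : Prop :=
  ∀ t, T ≤ t → runIndex 0 (bbsMove^[t] s) = f

/-- Run indices form a decreasing sequence in the well-founded pointwise order on functions from a
finite set to the naturals. -/
theorem exists_isLimitIndex {s : Fin n → ℕ} (hs : Function.Injective s) :
    ∃ f T, IsLimitIndex s f T := by
  have hanti : Antitone fun t => runIndex 0 (bbsMove^[t] s) := by
    refine antitone_nat_of_succ_le fun t => ?_
    rw [Function.iterate_succ_apply']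
    exact runIndex_bbsMove_le (bbsMove_iterate_injective hs t)
  obtain ⟨T, hT⟩ := WellFoundedLT.antitone_chain_condition hanti
  exact ⟨_, T, fun t ht => (hT t ht).symm⟩

theorem IsLimitIndex.levelCount_eq {s f : Fin n → ℕ} {T : ℕ} (h : IsLimitIndex s f T)
    (hs : Function.Injective s) (k t : ℕ) :
    levelCount (descentSet (config 0 (bbsMove^[T + t] s))) k =
      levelCount (descentSet (config 0 (bbsMove^[T] s))) k + t * rowSize f k := by
  induction t with
  | zero => simp
  | succ t ih =>
    have h1 := levelCount_bbsMove (bbsMove_iterate_injective hs (T + t))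
      (by rw [← Function.iterate_succ_apply' bbsMove, h _ (by omega), h _ (by omega)]) k
    rw [← Function.iterate_succ_apply' bbsMove, ih, h _ (by omega)] at h1
    rw [← add_assoc, h1]
    ring

theorem le_of_forall_add_mul_le {a b c d : ℕ} (h : ∀ t, a + t * b ≤ c + t * d) : b ≤ d := by
  by_contra hcon
  -- If `b` exceeds `d`, then `c + 1` steps are enough to overcome the head start `c`.
  have h1 := h (c + 1)
  have h2 : (c + 1) * (d + 1) ≤ (c + 1) * b := Nat.mul_le_mul le_rfl (by omega)
  rw [mul_add] at h2
  omega

theorem IsLimitIndex.rowSize_antitone {s f : Fin n → ℕ} {T : ℕ} (h : IsLimitIndex s f T)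
    (hs : Function.Injective s) : Antitone (rowSize f) := fun i k hik =>
  le_of_forall_add_mul_le fun t => by
    rw [← h.levelCount_eq hs, ← h.levelCount_eq hs]
    exact levelCount_antitone (finite_descentSet_config (bbsMove_iterate_injective hs _)) hik

theorem IsLimitIndex.mono {s f : Fin n → ℕ} {T T' : ℕ} (h : IsLimitIndex s f T) (hT : T ≤ T') :
    IsLimitIndex s f T' := fun t ht => h t (hT.trans ht)

theorem IsLimitIndex.unique {s f g : Fin n → ℕ} {T T' : ℕ} (h : IsLimitIndex s f T)
    (h' : IsLimitIndex s g T') : f = g := by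
  rw [← h (max T T') (le_max_left _ _), h' (max T T') (le_max_right _ _)]

/-- Level counts eventually grow linearly, with the row sizes as slopes; staying within distance one
makes the slopes equal. -/
theorem IsLimitIndex.rowSize_eq {s s' f f' : Fin n → ℕ} {T T' : ℕ} (h : IsLimitIndex s f T)
    (h' : IsLimitIndex s' f' T') (hs : Function.Injective s) (hs' : Function.Injective s')
    (hle : ∀ t k, levelCount (descentSet (config 0 (bbsMove^[t] s))) k ≤
      levelCount (descentSet (config 0 (bbsMove^[t] s'))) k + 1)
    (hle' : ∀ t k, levelCount (descentSet (config 0 (bbsMove^[t] s'))) k ≤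
      levelCount (descentSet (config 0 (bbsMove^[t] s))) k + 1) : rowSize f = rowSize f' := by
  have h1 := h.mono (le_max_left T T')
  have h2 := h'.mono (le_max_right T T')
  ext k
  have h3 : ∀ t, levelCount (descentSet (config 0 (bbsMove^[max T T'] s))) k + t * rowSize f k ≤
      levelCount (descentSet (config 0 (bbsMove^[max T T'] s'))) k + 1 + t * rowSize f' k := by
    intro t
    have := hle (max T T' + t) k
    rw [h1.levelCount_eq hs, h2.levelCount_eq hs'] at this
    omega
  have h4 : ∀ t, levelCount (descentSet (config 0 (bbsMove^[max T T'] s'))) k + t * rowSize f' k ≤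
      levelCount (descentSet (config 0 (bbsMove^[max T T'] s))) k + 1 + t * rowSize f k := by
    intro t
    have := hle' (max T T' + t) k
    rw [h1.levelCount_eq hs, h2.levelCount_eq hs'] at this
    omega
  exact le_antisymm (le_of_forall_add_mul_le h3) (le_of_forall_add_mul_le h4)

theorem eq_of_rowSize_eq {f g : Fin n → ℕ} (h : rowSize f = rowSize g) {a : Fin n}
    (hne : ∀ j, j ≠ a → f j = g j) : f = g := by
  have key : ∀ (e : Fin n → ℕ) k, rowSize e k =
      (if e a = k then 1 else 0) + ((Finset.univ.erase a).filter fun j => e j = k).card := by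
    intro e k
    rw [rowSize, ← Finset.insert_erase (Finset.mem_univ a), Finset.filter_insert]
    split_ifs with hk
    · rw [Finset.card_insert_of_notMem (by simp), add_comm]
      simp
    · simp
  have hrest : ((Finset.univ.erase a).filter fun j => f j = f a) =
      ((Finset.univ.erase a).filter fun j => g j = f a) :=
    Finset.filter_congr fun j hj => by rw [hne j (Finset.ne_of_mem_erase hj)]
  have h1 := congrFun h (f a)
  rw [key f, key g, hrest, if_pos rfl] at h1
  have h2 : g a = f a := by
    by_contra hcon
    rw [if_neg hcon] at h1
    omega
  ext j
  by_cases hj : j = a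
  · rw [hj, h2]
  · exact hne j hj

/-- The column condition: it says that the rows of sizes `rowSize f k`, where row `k` consists of
the balls with value `k`, have increasing columns. -/
def ColumnStrict (f : Fin n → ℕ) : Prop :=
  ∀ (k : ℕ) (m : Fin n), (Finset.univ.filter fun j => f j = k + 1 ∧ j ≤ m).card ≤
    (Finset.univ.filter fun j => f j = k ∧ j < m).card

/-- The balls of run `k + 1` occupy distinct positions of tail count `k + 1`, so they fit into the
gap between the two levels. -/
theorem rowSize_add_levelCount_le {s : Fin n → ℕ} (hs : Function.Injective s) (k : ℕ) :
    levelCount (descentSet (config 0 s)) (k + 1) + rowSize (runIndex 0 s) (k + 1) ≤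
      levelCount (descentSet (config 0 s)) k := by
  have hD := finite_descentSet_config (i := 0) hs
  rw [levelCount_eq_add hD k, rowSize]
  refine Nat.add_le_add_left ?_ _
  have hinj : Function.Injective fun j => s j + 1 := fun j k h => hs (Nat.succ_injective h)
  rw [← Finset.card_image_of_injective _ hinj, ← Set.ncard_coe_finset]
  refine Set.ncard_le_ncard (fun x hx => ?_)
    ((finite_setOf_lt_tailCount hD k).subset fun x hx => ?_)
  · simp only [Finset.coe_image, Set.mem_image, Finset.mem_coe, Finset.mem_filter,
      Finset.mem_univ, true_and] at hx
    obtain ⟨j, hj, rfl⟩ := hx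
    exact hj
  · simp only [Set.mem_ofPred_eq] at hx ⊢
    omega

/-- Consider the first ball `b` to leave its run `k + 1`. The gap between the ends of runs `k + 1`
and `k` was at least the size of run `k + 1` at the start. Column strictness says that run `k` has
since lost more steps' worth of balls below `b` to jumps than run `k + 1` has, so the gap is now
strictly larger than that size. But a ball can leave only if the whole gap is occupied. -/
theorem runIndex_bbsMove_of_columnStrict {s : Fin n → ℕ} (hs : Function.Injective s)
    (hcol : ColumnStrict (runIndex 0 s)) : runIndex 0 (bbsMove s) = runIndex 0 s := by
  have key : ∀ i, i ≤ n → ∀ i', i' ≤ i → runIndex i' (partialMove s i') = runIndex 0 s := by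
    intro i
    induction i with
    | zero => intro _ i' hi'; rw [Nat.le_zero.1 hi']; rfl
    | succ i ih =>
      intro hi i' hi'
      rcases hi'.lt_or_eq with h | rfl
      · exact ih (by omega) i' (by omega)
      have hi0 := ih (by omega) i le_rfl
      have hinj := partialMove_injective hs i
      set b : Fin n := ⟨i, hi⟩ with hb
      have hsucc : partialMove s (i + 1) = moveBall (partialMove s i) b := partialMove_succ s b
      have hlev := levelCount_partialMove hs (runIndex 0 s) (i := i) (by omega)
        fun j hj => by rw [ih (by omega) j (by omega)]
      ext j
      rw [hsucc]
      by_cases hj : j = b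
      · subst hj
        by_contra hcon
        rw [← hi0] at hcon
        have h1 := ncard_tailCount_eq_of_moveBall_ne hinj b hcon
        have h2 := lt_of_le_of_ne (runIndex_moveBall_le hinj b b) hcon
        change runIndex (i + 1) _ b < runIndex i _ b at h2
        obtain ⟨k, hk⟩ : ∃ k, runIndex i (partialMove s i) b = k + 1 :=
          Nat.exists_eq_add_of_lt (Nat.zero_lt_of_lt h2) |>.imp fun k hk => by omega
        change {x | tailCount (descentSet (config i (partialMove s i))) x =
          runIndex i (partialMove s i) b}.ncard ≤
            rowSize (runIndex i (partialMove s i)) (runIndex i (partialMove s i) b) at h1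
        rw [hk, hi0] at h1
        have h3 := levelCount_eq_add (finite_descentSet_config (i := i) hinj) k
        have h4 := hlev k
        have h5 := hlev (k + 1)
        have h6 := rowSize_add_levelCount_le hs k
        have h7 := hcol k b
        have h8 : (Finset.univ.filter fun j : Fin n => runIndex 0 s j = k + 1 ∧ j ≤ b).card =
            (Finset.univ.filter fun j : Fin n => runIndex 0 s j = k + 1 ∧ (j : ℕ) < i).card + 1 := by
          rw [← Finset.card_insert_of_notMem (a := b) (by simp [hb])]
          congr 1
          ext j
          simp only [Finset.mem_insert, Finset.mem_filter, Finset.mem_univ, true_and]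
          constructor
          · rintro ⟨h1, h2⟩
            rcases h2.lt_or_eq with h3 | h3
            · exact Or.inr ⟨h1, h3⟩
            · exact Or.inl h3
          · rintro (rfl | ⟨h1, h2⟩)
            · exact ⟨by rw [← hi0, hk], le_rfl⟩
            · exact ⟨h1, Fin.le_def.2 h2.le⟩
        have h9 : (Finset.univ.filter fun j : Fin n => runIndex 0 s j = k ∧ j < b).card =
            (Finset.univ.filter fun j : Fin n => runIndex 0 s j = k ∧ (j : ℕ) < i).card := rfl
        omega
      · rw [← hi0]
        exact runIndex_moveBall_of_ne hinj hj
  rw [← runIndex_partialMove_self hs]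
  exact key n le_rfl n le_rfl

theorem isLimitIndex_of_columnStrict {s : Fin n → ℕ} (hs : Function.Injective s)
    (hcol : ColumnStrict (runIndex 0 s)) : IsLimitIndex s (runIndex 0 s) 0 := by
  intro t _
  induction t with
  | zero => rfl
  | succ t ih =>
    rw [Function.iterate_succ_apply', runIndex_bbsMove_of_columnStrict
      (bbsMove_iterate_injective hs t) (by rw [ih (Nat.zero_le t)]; exact hcol), ih (Nat.zero_le t)]

end Evolution

/-! ### Proper Knuth moves commute with the box-ball system -/

section Swap

/-- The sequence `Y` is obtained from `X` by exchanging the letters at the positions `i + 1` and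
`i + 2`, which form an ascent of `X`. -/
structure IsSwap (X Y : ℕ → ℕ) (i : ℕ) : Prop where
  lt : X (i + 1) < X (i + 2)
  left : Y (i + 1) = X (i + 2)
  right : Y (i + 2) = X (i + 1)
  other : ∀ x, x ≠ i + 1 → x ≠ i + 2 → Y x = X x

/-- An exchange of two adjacent letters is proper if exactly one of the neighbouring letters lies
between them. -/
structure IsProperSwap (X Y : ℕ → ℕ) (i : ℕ) : Prop extends IsSwap X Y i where
  neighbours : (X (i + 1) < X i ∧ X i ≤ X (i + 2)) ↔
    ¬ (X (i + 1) ≤ X (i + 3) ∧ X (i + 3) < X (i + 2))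

variable {E m M p q p₂ q₂ i : ℕ} {X X' Y Y' : ℕ → ℕ}

theorem IsJump.apply_cases (h : IsJump E m M X X' p q) (x : ℕ) :
    (x = p ∧ X' x = E ∧ X x = m) ∨ (x = q ∧ X' x = M ∧ X x = E) ∨
      (x ≠ p ∧ x ≠ q ∧ X' x = X x) := by
  by_cases hp : x = p
  · subst hp; exact Or.inl ⟨rfl, h.apply_left', h.apply_left⟩
  · by_cases hq : x = q
    · subst hq; exact Or.inr (Or.inl ⟨rfl, h.apply_right', h.apply_right⟩)
    · exact Or.inr (Or.inr ⟨hp, hq, h.apply_of_ne x hp hq⟩)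

theorem IsJump.right_eq (h : IsJump E m M X X' p q) {r : ℕ} (hr : X r = E) (hpr : p < r)
    (hlt : ∀ x, p < x → x < r → X x < E) : q = r := by
  rcases lt_trichotomy q r with h1 | h1 | h1
  · have := hlt q h.lt h1
    have := h.apply_right
    omega
  · exact h1
  · have := h.lt_of_between r hpr h1
    omega

theorem IsJump.left_eq (h : IsJump E m M X X' p q) {r : ℕ} (hr : X r = m) : r = p := by
  by_contra hcon
  have := h.lt_of_ne r hcon
  omega

/-- The same jump happens in both sequences. It may change a neighbour of the exchanged pair, but
not whether that neighbour lies between the two, because `m` is below all other letters while `M`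
and `E` are above all others. -/
theorem IsProperSwap.jump_other (h : IsProperSwap X Y i) (hX : IsJump E m M X X' p q)
    (hY : IsJump E m M Y Y' p₂ q₂) (hp : p ≠ i + 1) (hq : q ≠ i + 2) : IsProperSwap X' Y' i := by
  obtain ⟨⟨hlt, hl, hr, ho⟩, hn⟩ := h
  have hpp := hX.apply_left
  have hqq := hX.apply_right
  have hpq := hX.lt
  have hME := hX.lt_top
  have e1 := hX.le_top (i + 1)
  have e2 := hX.le_top (i + 2)
  have m0 := hX.lt_of_ne (i + 1) (Ne.symm hp)
  have hp2 : p ≠ i + 2 := by rintro rfl; omega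
  have hq1 : q ≠ i + 1 := by rintro rfl; omega
  obtain rfl : p = p₂ := hY.left_eq (by rw [ho p hp hp2, hpp])
  obtain rfl : q₂ = q := hY.right_eq (by rw [ho q hq1 hq, hqq]) hpq fun x hx1 hx2 => by
    by_cases h1 : x = i + 1
    · rw [h1, hl]; exact hX.lt_of_between _ (by omega) (by omega)
    · by_cases h2 : x = i + 2
      · rw [h2, hr]; omega
      · rw [ho x h1 h2]; exact hX.lt_of_between x hx1 hx2
  have a1 := hX.apply_of_ne (i + 1) (Ne.symm hp) (Ne.symm hq1)
  have a2 := hX.apply_of_ne (i + 2) (Ne.symm hp2) (Ne.symm hq)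
  refine ⟨⟨by omega, ?_, ?_, fun x hx1 hx2 => ?_⟩, ?_⟩
  · rw [hY.apply_of_ne _ (Ne.symm hp) (Ne.symm hq1), hl, a2]
  · rw [hY.apply_of_ne _ (Ne.symm hp2) (Ne.symm hq), hr, a1]
  · have := ho x hx1 hx2
    rcases hX.apply_cases x with h1 | h1 | h1 <;> rcases hY.apply_cases x with h2 | h2 | h2 <;> omega
  · rw [a1, a2]
    have b2 := hX.lt_of_between (i + 2)
    have l1 := hX.lt_of_lt_top (i + 1) (by omega)
    have l2 := hX.lt_of_lt_top (i + 2)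
    have c0 := hX.apply_cases i
    have c3 := hX.apply_cases (i + 3)
    rcases c0 with c0 | c0 | c0 <;> rcases c3 with c3 | c3 | c3 <;> omega

/-- Here the larger exchanged letter is an empty box. The ball lands on it in either sequence, and
it is replaced by `M` on both sides. -/
theorem IsProperSwap.jump_onto (h : IsProperSwap X Y i) (hX : IsJump E m M X X' p (i + 2))
    (hY : IsJump E m M Y Y' p₂ q₂) (hp : p ≠ i + 1) : IsProperSwap X' Y' i := by
  obtain ⟨⟨hlt, hl, hr, ho⟩, hn⟩ := h
  have hpp := hX.apply_left
  have hqq := hX.apply_right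
  have hpq := hX.lt
  have hME := hX.lt_top
  have m0 := hX.lt_of_ne (i + 1) (Ne.symm hp)
  obtain rfl : p = p₂ := hY.left_eq (by rw [ho p hp (by omega), hpp])
  obtain rfl : q₂ = i + 1 := hY.right_eq (by rw [hl, hqq]) (by omega) fun x hx1 hx2 => by
    rw [ho x (by omega) (by omega)]; exact hX.lt_of_between x hx1 (by omega)
  have a1 := hX.apply_of_ne (i + 1) (Ne.symm hp) (by omega)
  have a2 := hX.apply_right'
  have l1 := hX.lt_of_lt_top (i + 1) (by omega)
  refine ⟨⟨by omega, ?_, ?_, fun x hx1 hx2 => ?_⟩, ?_⟩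
  · rw [hY.apply_right', a2]
  · rw [hY.apply_of_ne _ (by omega) (by omega), hr, a1]
  · have := ho x hx1 hx2
    rcases hX.apply_cases x with h1 | h1 | h1 <;> rcases hY.apply_cases x with h2 | h2 | h2 <;> omega
  · rw [a1, a2]
    have b0 := hX.lt_of_between i
    have l0 := hX.lt_of_lt_top i
    have l3 := hX.lt_of_lt_top (i + 3)
    have e0 := hX.le_top i
    have e3 := hX.le_top (i + 3)
    have c0 := hX.apply_cases i
    have c3 := hX.apply_cases (i + 3)
    rcases c0 with c0 | c0 | c0 <;> rcases c3 with c3 | c3 | c3 <;> omega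

/-- The jumping ball is itself exchanged with an empty box: it is one position ahead in `Y` and
stays one ahead, so the exchange moves to `i + 1`. -/
theorem IsProperSwap.jump_single (h : IsProperSwap X Y i) (hX : IsJump E m M X X' (i + 1) (i + 2))
    (hY : IsJump E m M Y Y' p₂ q₂) : IsProperSwap X' Y' (i + 1) := by
  obtain ⟨⟨hlt, hl, hr, ho⟩, hn⟩ := h
  have hpp := hX.apply_left
  have hqq := hX.apply_right
  have hME := hX.lt_top
  have m0 := hX.lt_of_ne i (by omega)
  have m3 := hX.lt_of_ne (i + 3) (by omega)
  have e0 := hX.le_top i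
  have e3 := hX.le_top (i + 3)
  -- The left neighbour lies between `m` and `E` automatically, so properness excludes the right
  -- one, which leaves only `E`.
  have hE : X (i + 3) = E := by omega
  obtain rfl : i + 2 = p₂ := hY.left_eq (by rw [hr, hpp])
  obtain rfl : q₂ = i + 3 := hY.right_eq (by rw [ho _ (by omega) (by omega), hE]) (by omega)
    fun x hx1 hx2 => by omega
  have a1 := hX.apply_left'
  have a2 := hX.apply_right'
  have a3 := hX.apply_of_ne (i + 3) (by omega) (by omega)
  refine ⟨⟨?_, ?_, ?_, fun x hx1 hx2 => ?_⟩, ?_⟩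
  · change X' (i + 2) < X' (i + 3)
    rw [a2, a3, hE]
    exact hME
  · change Y' (i + 2) = X' (i + 3)
    rw [hY.apply_left', a3, hE]
  · change Y' (i + 3) = X' (i + 2)
    rw [hY.apply_right', a2]
  · by_cases hx : x = i + 1
    · rw [hx, hY.apply_of_ne (i + 1) (by omega) (by omega), hl, a1, hqq]
    have := ho x hx hx1
    rcases hX.apply_cases x with h1 | h1 | h1 <;> rcases hY.apply_cases x with h2 | h2 | h2 <;> omega
  · change (X' (i + 2) < X' (i + 1) ∧ X' (i + 1) ≤ X' (i + 3)) ↔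
      ¬ (X' (i + 2) ≤ X' (i + 4) ∧ X' (i + 4) < X' (i + 3))
    rw [a1, a2, a3, hE]
    have l4 := hX.lt_of_lt_top (i + 4)
    have e4 := hX.le_top (i + 4)
    have c4 := hX.apply_cases (i + 4)
    omega

/-- The jumping letter turns from the smaller of the pair into an empty box, the larger one; hence
`X'` and `Y'` change roles. Both jumps land in the same place. -/
theorem IsProperSwap.jump_left (h : IsProperSwap X Y i) (hX : IsJump E m M X X' (i + 1) q)
    (hY : IsJump E m M Y Y' p₂ q₂) (hq : q ≠ i + 2) (hinj : X i ≠ X (i + 2)) :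
    IsProperSwap Y' X' i := by
  obtain ⟨⟨hlt, hl, hr, ho⟩, hn⟩ := h
  have hpp := hX.apply_left
  have hqq := hX.apply_right
  have hpq := hX.lt
  have hME := hX.lt_top
  have m0 := hX.lt_of_ne i (by omega)
  have m3 := hX.lt_of_ne (i + 3) (by omega)
  have e0 := hX.le_top i
  have e3 := hX.le_top (i + 3)
  have b2 := hX.lt_of_between (i + 2) (by omega) (by omega)
  obtain rfl : i + 2 = p₂ := hY.left_eq (by rw [hr, hpp])
  obtain rfl : q₂ = q := hY.right_eq (by rw [ho _ (by omega) (by omega), hqq]) (by omega)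
    fun x hx1 hx2 => by
      rw [ho x (by omega) (by omega)]
      exact hX.lt_of_between x (by omega) hx2
  have a1 := hX.apply_left'
  have a2 := hX.apply_of_ne (i + 2) (by omega) (by omega)
  have d1 := hY.apply_of_ne (i + 1) (by omega) (by omega)
  have d2 := hY.apply_left'
  have d0 := hY.apply_of_ne i (by omega) (by omega)
  refine ⟨⟨by omega, by omega, by omega, fun x hx1 hx2 => ?_⟩, ?_⟩
  · have := ho x hx1 hx2
    rcases hX.apply_cases x with h1 | h1 | h1 <;> rcases hY.apply_cases x with h2 | h2 | h2 <;> omega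
  · rw [d0, d1, d2, hl, ho i (by omega) (by omega)]
    have n0 := hX.lt_of_lt_top (i + 2) b2
    have o3 := ho (i + 3) (by omega) (by omega)
    have b3 := hX.lt_of_between (i + 3) (by omega)
    have c3 := hY.apply_cases (i + 3)
    rcases c3 with c3 | c3 | c3 <;> omega

/-- Proper exchanges commute with jumps if the letters other than `E` are distinct. -/
theorem IsProperSwap.jump (h : IsProperSwap X Y i) (hX : IsJump E m M X X' p q)
    (hY : IsJump E m M Y Y' p₂ q₂) (hinj : ∀ x y, X x = X y → X x < E → x = y) :
    ∃ k, IsProperSwap X' Y' k ∨ IsProperSwap Y' X' k := by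
  by_cases hp : p = i + 1
  · subst hp
    by_cases hq : q = i + 2
    · subst hq
      exact ⟨_, Or.inl (h.jump_single hX hY)⟩
    · have hlt : i + 2 < q := by
        have := hX.lt
        omega
      refine ⟨_, Or.inr (h.jump_left hX hY hq fun heq => ?_)⟩
      have := hinj _ _ heq (heq ▸ hX.lt_of_between (i + 2) (by omega) hlt)
      omega
  · by_cases hq : q = i + 2
    · subst hq
      exact ⟨_, Or.inl (h.jump_onto hX hY hp)⟩
    · exact ⟨_, Or.inl (h.jump_other hX hY hp hq)⟩

/-- The exchange creates a descent at `i + 1`. If the left neighbour lies between, the one at `i`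
disappears; if the right one does, the one at `i + 2` disappears. The weak and strict inequalities
in `neighbours` are those of descents, which matters for repeated empty boxes. -/
theorem IsProperSwap.isHop (h : IsProperSwap X Y i) :
    IsHop (descentSet X) (descentSet Y) i ∨ IsHop (descentSet Y) (descentSet X) (i + 1) := by
  obtain ⟨⟨hlt, hl, hr, ho⟩, hn⟩ := h
  have h0 := ho i (by omega) (by omega)
  have h3 := ho (i + 3) (by omega) (by omega)
  have hother : ∀ y, y ≠ i → y ≠ i + 1 → y ≠ i + 2 → (y ∈ descentSet Y ↔ y ∈ descentSet X) := by
    intro y h1 h2 h3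
    rw [mem_descentSet, mem_descentSet, ho y h2 h3, ho (y + 1) (by omega) (by omega)]
  by_cases hc : X (i + 1) < X i ∧ X i ≤ X (i + 2)
  · refine Or.inl ⟨?_, ?_, ?_, ?_, fun y h1 h2 => ?_⟩
    · simp only [mem_descentSet]; omega
    · simp only [mem_descentSet, add_assoc, Nat.reduceAdd]; omega
    · simp only [mem_descentSet]; omega
    · simp only [mem_descentSet, add_assoc, Nat.reduceAdd]; omega
    · by_cases h3 : y = i + 2
      · subst h3
        simp only [mem_descentSet, add_assoc, Nat.reduceAdd]; omega
      · exact hother y h1 h2 h3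
  · refine Or.inr ⟨?_, ?_, ?_, ?_, fun y h1 h2 => ?_⟩
    · simp only [mem_descentSet, add_assoc, Nat.reduceAdd]; omega
    · simp only [mem_descentSet, add_assoc, Nat.reduceAdd]; omega
    · simp only [mem_descentSet, add_assoc, Nat.reduceAdd]; omega
    · simp only [mem_descentSet, add_assoc, Nat.reduceAdd]; omega
    · by_cases h3 : y = i
      · subst h3
        simp only [mem_descentSet]; omega
      · exact (hother y h3 h1 h2).symm

theorem IsHop.levelCount_le {D D' : Set ℕ} {u : ℕ} (h : IsHop D D' u) (hD : D.Finite)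
    (hD' : D'.Finite) (k : ℕ) :
    levelCount D k ≤ levelCount D' k + 1 ∧ levelCount D' k ≤ levelCount D k + 1 := by
  rw [h.levelCount_eq hD hD']
  split_ifs <;> omega

end Swap

/-! ### Proper adjacency of states and equality of their limit indices -/

section SwapStates

variable {n : ℕ} {s s' : Fin n → ℕ}

/-- The labelled configurations of two states differ by a proper exchange of adjacent letters. -/
def ProperlyAdjacent (i : ℕ) (s s' : Fin n → ℕ) : Prop :=
  ∃ k, IsProperSwap (config i s) (config i s') k ∨ IsProperSwap (config i s') (config i s) k

theorem ProperlyAdjacent.symm {i : ℕ} (h : ProperlyAdjacent i s s') : ProperlyAdjacent i s' s :=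
  h.imp fun _ => Or.symm

theorem config_injOn {i : ℕ} (hs : Function.Injective s) (x y : ℕ)
    (hxy : config i s x = config i s y) (hx : config i s x < 2 * n) : x = y := by
  obtain ⟨j, rfl⟩ := (config_lt_iff hs).1 hx
  rw [config_ball hs] at hxy
  exact (config_eq_ballLabel_iff hs).1 hxy.symm

theorem ProperlyAdjacent.moveBall (hs : Function.Injective s) (hs' : Function.Injective s')
    (i : Fin n) (h : ProperlyAdjacent i s s') :
    ProperlyAdjacent (i + 1) (moveBall s i) (moveBall s' i) := by
  obtain ⟨k, h | h⟩ := h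
  · exact h.jump (isJump_moveBall hs i) (isJump_moveBall hs' i) (config_injOn hs)
  · exact ProperlyAdjacent.symm
      (h.jump (isJump_moveBall hs' i) (isJump_moveBall hs i) (config_injOn hs'))

theorem IsProperSwap.config_zero_of_config_self (hs : Function.Injective s)
    (hs' : Function.Injective s') {k : ℕ} (h : IsProperSwap (config n s) (config n s') k) :
    IsProperSwap (config 0 s) (config 0 s') k := by
  obtain ⟨⟨h1, h2, h3, h4⟩, h5⟩ := h
  have a0 := config_self_eq hs k
  have a1 := config_self_eq hs (k + 1)
  have a2 := config_self_eq hs (k + 2)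
  have a3 := config_self_eq hs (k + 3)
  have b1 := config_self_eq hs' (k + 1)
  have b2 := config_self_eq hs' (k + 2)
  refine ⟨⟨by omega, by omega, by omega, fun x hx1 hx2 => ?_⟩, by omega⟩
  have := h4 x hx1 hx2
  have a := config_self_eq hs x
  have b := config_self_eq hs' x
  omega

theorem ProperlyAdjacent.bbsMove (hs : Function.Injective s) (hs' : Function.Injective s')
    (h : ProperlyAdjacent 0 s s') : ProperlyAdjacent 0 (bbsMove s) (bbsMove s') := by
  have key : ∀ i, i ≤ n → ProperlyAdjacent i (partialMove s i) (partialMove s' i) := by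
    intro i
    induction i with
    | zero => exact fun _ => h
    | succ i ih =>
      intro hi
      have := ProperlyAdjacent.moveBall (partialMove_injective hs i)
        (partialMove_injective hs' i) ⟨i, hi⟩ (ih (by omega))
      rwa [← partialMove_succ s ⟨i, hi⟩, ← partialMove_succ s' ⟨i, hi⟩] at this
  rw [bbsMove_eq_partialMove, bbsMove_eq_partialMove]
  have hi := partialMove_injective hs n
  have hi' := partialMove_injective hs' n
  exact (key n le_rfl).imp fun k =>
    Or.imp (fun h => h.config_zero_of_config_self hi hi') fun h =>
      h.config_zero_of_config_self hi' hi

theorem ProperlyAdjacent.bbsMove_iterate (hs : Function.Injective s) (hs' : Function.Injective s')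
    (h : ProperlyAdjacent 0 s s') (t : ℕ) :
    ProperlyAdjacent 0 (_root_.bbsMove^[t] s) (_root_.bbsMove^[t] s') := by
  induction t with
  | zero => exact h
  | succ t ih =>
    rw [Function.iterate_succ_apply', Function.iterate_succ_apply']
    exact ProperlyAdjacent.bbsMove (bbsMove_iterate_injective hs t)
      (bbsMove_iterate_injective hs' t) ih

theorem ProperlyAdjacent.levelCount_le (hs : Function.Injective s) (hs' : Function.Injective s')
    (h : ProperlyAdjacent 0 s s') (k : ℕ) :
    levelCount (descentSet (config 0 s)) k ≤ levelCount (descentSet (config 0 s')) k + 1 := by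
  have hD := finite_descentSet_config (i := 0) hs
  have hD' := finite_descentSet_config (i := 0) hs'
  obtain ⟨i, h | h⟩ := h
  · rcases h.isHop with h | h
    · exact (h.levelCount_le hD hD' k).1
    · exact (h.levelCount_le hD' hD k).2
  · rcases h.isHop with h | h
    · exact (h.levelCount_le hD' hD k).2
    · exact (h.levelCount_le hD hD' k).1

theorem ProperlyAdjacent.tailCount_zero_eq (hs : Function.Injective s)
    (hs' : Function.Injective s') (h : ProperlyAdjacent 0 s s') :
    tailCount (descentSet (config 0 s)) 0 = tailCount (descentSet (config 0 s')) 0 := by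
  have hD := finite_descentSet_config (i := 0) hs
  have hD' := finite_descentSet_config (i := 0) hs'
  obtain ⟨i, h | h⟩ := h
  · rcases h.isHop with h | h
    · exact (h.tailCount_eq hD hD' (by omega)).symm
    · exact h.tailCount_eq hD' hD (by omega)
  · rcases h.isHop with h | h
    · exact h.tailCount_eq hD' hD (by omega)
    · exact (h.tailCount_eq hD hD' (by omega)).symm

/-- The tail counts differ at a single position. Of the two exchanged letters, one passes between
positions with equal tail counts, because `k + 1` is not a descent of `config 0 s`; only the other
can change its index. -/
theorem IsProperSwap.exists_runIndex_eq (hs : Function.Injective s) (hs' : Function.Injective s')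
    {k : ℕ} (h : IsProperSwap (config 0 s) (config 0 s') k) :
    ∃ a, ∀ j, j ≠ a → runIndex 0 s j = runIndex 0 s' j := by
  have hD := finite_descentSet_config (i := 0) hs
  have hD' := finite_descentSet_config (i := 0) hs'
  have hpos : ∀ j, config 0 s (s' j + 1) = config 0 s' (s' j + 1) → s' j = s j := fun j hj => by
    rw [config_ball hs' j, config_eq_ballLabel_iff hs] at hj
    omega
  have hother : ∀ j, s' j ≠ k → s' j ≠ k + 1 → s' j = s j := fun j h1 h2 =>
    hpos j (h.other _ (by omega) (by omega)).symm
  obtain ⟨a, ha⟩ := (config_lt_iff hs).1 (h.lt.trans_le (config_le hs _))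
  have ha' : s' a + 1 = k + 2 := by
    rw [← config_eq_ballLabel_iff (i := 0) hs', h.right, ← ha, config_ball hs]
  rcases h.isHop with hop | hop
  · have e1 := hop.tailCount_succ hD'
    by_cases hb : ∃ b, s b + 1 = k + 2
    · obtain ⟨b, hb⟩ := hb
      have hb' : s' b + 1 = k + 1 := by
        rw [← config_eq_ballLabel_iff (i := 0) hs', h.left, ← hb, config_ball hs]
      refine ⟨b, fun j hj => ?_⟩
      have hjb : s' j ≠ s' b := fun h => hj (hs' h)
      by_cases hja : j = a
      · subst hja
        rw [runIndex, runIndex, ha, ha', hop.tailCount_eq hD hD' (by omega),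
          tailCount_of_notMem hop.succ_notMem]
      · have hja' : s' j ≠ s' a := fun h => hja (hs' h)
        rw [runIndex, runIndex, ← hother j (by omega) (by omega),
          hop.tailCount_eq hD hD' (by omega)]
    · push Not at hb
      have hE : config 0 s' (k + 1) = 2 * n := by rw [h.left, config_of_forall_ne hb]
      -- The other exchanged letter is an empty box, so any ball may be named as the exception;
      -- naming `a` spares its verification.
      refine ⟨a, fun j hj => ?_⟩
      have hja' : s' j ≠ s' a := fun h => hj (hs' h)
      have hj1 : s' j ≠ k := fun hcon => by
        have := (config_lt_iff (i := 0) hs').2 ⟨j, by rw [hcon]⟩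
        omega
      rw [runIndex, runIndex, ← hother j (by omega) (by omega), hop.tailCount_eq hD hD' (by omega)]
  · refine ⟨a, fun j hj => ?_⟩
    have hja' : s' j ≠ s' a := fun h => hj (hs' h)
    by_cases hj1 : s' j = k
    · have hj2 : s j + 1 = k + 2 := by
        rw [← config_eq_ballLabel_iff (i := 0) hs, ← h.left, ← hj1, config_ball hs']
      have hnot : k + 1 ∉ descentSet (config 0 s) := hop.notMem'
      rw [runIndex, runIndex, hj1, hj2, ← tailCount_of_notMem hnot,
        hop.tailCount_eq hD' hD (by omega)]
    · rw [runIndex, runIndex, ← hother j hj1 (by omega), hop.tailCount_eq hD' hD (by omega)]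

theorem ProperlyAdjacent.exists_runIndex_eq (hs : Function.Injective s)
    (hs' : Function.Injective s') (h : ProperlyAdjacent 0 s s') :
    ∃ a, ∀ j, j ≠ a → runIndex 0 s j = runIndex 0 s' j := by
  obtain ⟨k, h | h⟩ := h
  · exact h.exists_runIndex_eq hs hs'
  · exact (h.exists_runIndex_eq hs' hs).imp fun a ha j hj => (ha j hj).symm

/-- Adjacency at all times gives equal row sizes. At a late time the limits differ at one ball at
most, and equal fibre sizes rule that out. -/
theorem ProperlyAdjacent.isLimitIndex_eq (hs : Function.Injective s)
    (hs' : Function.Injective s') (h : ProperlyAdjacent 0 s s') {f f' : Fin n → ℕ} {T T' : ℕ}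
    (hf : IsLimitIndex s f T) (hf' : IsLimitIndex s' f' T') : f = f' := by
  have hadj := h.bbsMove_iterate hs hs'
  have hi := bbsMove_iterate_injective hs
  have hi' := bbsMove_iterate_injective hs'
  obtain ⟨a, ha⟩ := (hadj (max T T')).exists_runIndex_eq (hi _) (hi' _)
  rw [hf _ (le_max_left _ _), hf' _ (le_max_right _ _)] at ha
  exact eq_of_rowSize_eq (hf.rowSize_eq hf' hs hs'
    (fun t k => (hadj t).levelCount_le (hi t) (hi' t) k)
    fun t k => (hadj t).symm.levelCount_le (hi' t) (hi t) k) ha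

end SwapStates

/-! ### The increasing runs are the fibres of the run index -/

section Runs

variable {n : ℕ}

/-- The list `G` consists of the fibres of `f`, each in increasing order. -/
def IsRowList (f : Fin n → ℕ) (G : List (List (Fin n))) : Prop :=
  (∀ g ∈ G, g ≠ [] ∧ g.Pairwise (· < ·)) ∧
    ∀ i j, (∃ g, G[i]? = some g ∧ j ∈ g) ↔ f j = i

theorem List.Pairwise.eq_of_forall_mem_iff {α : Type*} [LinearOrder α] {l l' : List α}
    (h : l.Pairwise (· < ·)) (h' : l'.Pairwise (· < ·)) (hmem : ∀ a, a ∈ l ↔ a ∈ l') : l = l' := by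
  have hp : l.Perm l' := (List.perm_ext_iff_of_nodup (h.imp fun hab => hab.ne)
    (h'.imp fun hab => hab.ne)).2 hmem
  exact hp.eq_of_pairwise (fun _ _ _ _ h1 h2 => absurd h1 (lt_asymm h2)) h h'

theorem IsRowList.mem_iff {f : Fin n → ℕ} {G : List (List (Fin n))} (h : IsRowList f G) {i : ℕ}
    {g : List (Fin n)} (hg : G[i]? = some g) (j : Fin n) : j ∈ g ↔ f j = i := by
  rw [← h.2 i j]
  exact ⟨fun hj => ⟨g, hg, hj⟩, fun ⟨g', hg', hj⟩ => by
    rw [hg] at hg'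
    exact (Option.some.inj hg') ▸ hj⟩

theorem IsRowList.unique {f : Fin n → ℕ} {G G' : List (List (Fin n))} (h : IsRowList f G)
    (h' : IsRowList f G') : G = G' := by
  have key : ∀ {G G' : List (List (Fin n))}, IsRowList f G → IsRowList f G' →
      ∀ (i : ℕ) (g : List (Fin n)), G[i]? = some g → G'[i]? = some g := by
    intro G G' h h' i g hg
    have hgG := h.1 g (List.mem_of_getElem? hg)
    obtain ⟨j, hj⟩ := List.exists_mem_of_ne_nil g hgG.1
    obtain ⟨g', hg', -⟩ := (h'.2 i j).2 ((h.mem_iff hg j).1 hj)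
    have hgG' := h'.1 g' (List.mem_of_getElem? hg')
    rw [hg', hgG.2.eq_of_forall_mem_iff hgG'.2 fun k => (h.mem_iff hg k).trans (h'.mem_iff hg' k).symm]
  refine List.ext_getElem? fun i => ?_
  rcases hi : G[i]? with _ | g
  · rcases hi' : G'[i]? with _ | g
    · rfl
    · rw [key h' h i g hi'] at hi
      exact absurd hi (by simp)
  · exact (key h h' i g hi).symm

theorem IsRowList.length_eq {f : Fin n → ℕ} {G : List (List (Fin n))} (h : IsRowList f G) {i : ℕ}
    {g : List (Fin n)} (hg : G[i]? = some g) : g.length = rowSize f i := by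
  have hnd : g.Nodup := (h.1 g (List.mem_of_getElem? hg)).2.imp fun hab => hab.ne
  rw [rowSize, ← List.toFinset_card_of_nodup hnd]
  congr 1
  ext j
  simp [h.mem_iff hg]

/-- If `f` is constant inside the blocks, drops by one at each break and ends at `0`, then it
numbers the blocks from the right. -/
theorem index_add_length_eq {α : Type*} {R : α → α → Bool} {f : α → ℕ} (G : List (List α))
    (hne : [] ∉ G) (hR : ∀ g ∈ G, g.IsChain fun a b => R a b)
    (hR' : G.IsChain fun a b => ∃ ha hb, R (a.getLast ha) (b.head hb) = false)
    (hf : G.flatten.IsChain fun a b => f a = f b + if R a b then 0 else 1)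
    (hlast : ∀ a ∈ G.flatten.getLast?, f a = 0) :
    ∀ k g, G[k]? = some g → ∀ j ∈ g, f j + k + 1 = G.length := by
  induction G with
  | nil => intro k g hg; simp at hg
  | cons g₀ G ih =>
    rw [List.mem_cons, not_or] at hne
    rw [List.flatten_cons, List.isChain_append] at hf
    have hg₀ : g₀ ≠ [] := fun h => hne.1 h.symm
    have ih' := ih hne.2 (fun g hg => hR g (List.mem_cons_of_mem _ hg)) hR'.tail hf.2.1 fun a ha => by
      refine hlast a ?_
      rw [List.flatten_cons, List.getLast?_append]
      rw [Option.mem_def] at ha ⊢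
      rw [ha, Option.some_or]
    have hconst : ∀ a ∈ g₀, f a = f (g₀.getLast hg₀) := by
      have hc : g₀.IsChain fun a b => f a = f b := by
        have h1 := hR g₀ List.mem_cons_self
        have h2 := hf.1
        rw [List.isChain_iff_getElem] at h1 h2 ⊢
        intro i hi
        have := h2 i hi
        rwa [if_pos (h1 i hi), add_zero] at this
      have hp : g₀.Pairwise fun a b => f a = f b :=
        (List.isChain_iff_pairwise (R := fun a b => f a = f b)).1 hc
      intro a ha
      rcases List.mem_iff_getElem.1 ha with ⟨i, hi, rfl⟩
      rw [List.getLast_eq_getElem]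
      rcases (Nat.le_sub_one_of_lt hi).lt_or_eq with h | h
      · exact List.pairwise_iff_getElem.1 hp _ _ _ _ h
      · congr 2
    have hend : f (g₀.getLast hg₀) = G.length := by
      cases G with
      | nil =>
        refine hlast _ ?_
        simp [List.getLast?_eq_getLast_of_ne_nil hg₀]
      | cons g₁ G =>
        have hg₁ : g₁ ≠ [] := fun h => hne.2 (by simp [h])
        obtain ⟨_, _, h2⟩ := hR'.rel
        have h3 := hf.2.2 (g₀.getLast hg₀) (by simp [List.getLast?_eq_getLast_of_ne_nil hg₀])
          (g₁.head hg₁) (by simp [List.head?_append, List.head?_eq_some_head hg₁])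
        rw [h2] at h3
        have h4 := ih' 0 g₁ rfl (g₁.head hg₁) (List.head_mem hg₁)
        simp only [Bool.false_eq_true, if_false] at h3
        omega
    intro k g hg j hj
    cases k with
    | zero =>
      obtain rfl : g₀ = g := by simpa using hg
      rw [hconst j hj, hend, List.length_cons]
    | succ k =>
      have := ih' k g (by simpa using hg) j hj
      rw [List.length_cons]
      omega

theorem ballOrder_perm (s : Fin n → ℕ) : (ballOrder s).Perm (List.finRange n) :=
  List.perm_insertionSort _ _

theorem ballOrder_pairwise {s : Fin n → ℕ} (hs : Function.Injective s) :
    (ballOrder s).Pairwise fun i j => s i < s j := by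
  have : Std.Total fun i j : Fin n => s i ≤ s j := ⟨fun i j => le_total _ _⟩
  have : IsTrans (Fin n) fun i j : Fin n => s i ≤ s j := ⟨fun i j k h h' => le_trans h h'⟩
  have h1 : (ballOrder s).Pairwise fun i j => s i ≤ s j :=
    List.pairwise_insertionSort (fun i j => s i ≤ s j) (List.finRange n)
  have h2 : (ballOrder s).Nodup := (ballOrder_perm s).nodup_iff.2 (List.nodup_finRange n)
  exact h1.imp₂ (fun i j hij hne => lt_of_le_of_ne hij fun h => hne (hs h)) h2

theorem ballOrder_eq {s : Fin n → ℕ} {L : List (Fin n)} (hL : L.Perm (List.finRange n))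
    (hp : L.Pairwise fun i j => s i < s j) (hs : Function.Injective s) : ballOrder s = L :=
  ((ballOrder_perm s).trans hL.symm).eq_of_pairwise
    (fun _ _ _ _ h1 h2 => absurd h1 (lt_asymm h2)) (ballOrder_pairwise hs) hp

/-- A stretch of empty boxes contributes one descent only, at its last position. -/
theorem tailCount_of_gap {E : ℕ} {X : ℕ → ℕ} (hD : (descentSet X).Finite) {x y : ℕ} (hxy : x < y)
    (hE : ∀ z, x ≤ z → z < y → X z = E) (hy : X y < E) :
    tailCount (descentSet X) x = tailCount (descentSet X) y + 1 := by
  obtain ⟨y, rfl⟩ : ∃ y', y = y' + 1 := ⟨y - 1, by omega⟩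
  rw [← tailCount_of_mem hD (by rw [mem_descentSet, hE y (by omega) (by omega)]; exact hy)]
  refine tailCount_eq_of_forall_notMem (by omega) fun z h1 h2 => ?_
  rw [mem_descentSet, hE z h1 (by omega), hE (z + 1) (by omega) (by omega)]
  exact lt_irrefl _

theorem runIndex_eq_of_forall_notMem {s : Fin n → ℕ} (hs : Function.Injective s) {a b : Fin n}
    (hab : s a < s b) (hno : ∀ j, s j ≤ s a ∨ s b ≤ s j) :
    runIndex 0 s a = runIndex 0 s b + if decide (s b = s a + 1 ∧ a < b) then 0 else 1 := by
  have hD := finite_descentSet_config (i := 0) hs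
  have ha := config_ball (i := 0) hs a
  have hb := config_ball (i := 0) hs b
  simp only [ballLabel, Nat.not_lt_zero, if_false] at ha hb
  rw [runIndex, runIndex]
  by_cases h1 : s b = s a + 1
  · rw [h1] at hb ⊢
    by_cases h2 : a < b
    · rw [tailCount_of_notMem (by rw [mem_descentSet]; omega)]
      simp [h2]
    · have : a ≠ b := by rintro rfl; omega
      rw [tailCount_of_mem hD (by rw [mem_descentSet]; omega)]
      simp [h2]
  · rw [tailCount_of_notMem, tailCount_of_gap hD (E := 2 * n) (show s a + 1 + 1 < s b + 1 by omega)]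
    · simp [h1]
    · intro z hz1 hz2
      exact config_of_forall_ne fun j hj => by have := hno j; omega
    · omega
    · rw [mem_descentSet, ha, config_of_forall_ne fun j hj => by have := hno j; omega]
      omega

theorem runIndex_last {s : Fin n → ℕ} (hs : Function.Injective s) {a : Fin n}
    (h : ∀ j, s j ≤ s a) : runIndex 0 s a = 0 := by
  refine tailCount_eq_zero fun z hz => ?_
  rw [mem_descentSet, not_lt, config_of_forall_ne (x := z + 1) fun j hj => by have := h j; omega]
  exact config_le hs z

/-- The hypothesis `hall` says that `L` is a final segment of the ball order, which is the form that
induction on `L` needs. -/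
theorem isChain_runIndex {s : Fin n → ℕ} (hs : Function.Injective s) (L : List (Fin n))
    (hL : L.Pairwise fun i j => s i < s j) (hall : ∀ j, j ∈ L ∨ ∀ b ∈ L, s j < s b) :
    (L.IsChain fun a b => runIndex 0 s a = runIndex 0 s b +
      if decide (s b = s a + 1 ∧ a < b) then 0 else 1) ∧ ∀ a ∈ L.getLast?, runIndex 0 s a = 0 := by
  induction L with
  | nil => simp
  | cons a L ih =>
    rw [List.pairwise_cons] at hL
    have ih' := ih hL.2 fun j => by
      rcases hall j with h | h
      · rcases List.mem_cons.1 h with rfl | h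
        · exact Or.inr hL.1
        · exact Or.inl h
      · exact Or.inr fun b hb => h b (List.mem_cons_of_mem _ hb)
    cases L with
    | nil =>
      refine ⟨by simp, ?_⟩
      intro b hb
      obtain rfl : a = b := by simpa using hb
      refine runIndex_last hs fun j => ?_
      rcases hall j with h | h
      · obtain rfl : j = a := by simpa using h
        exact le_rfl
      · exact (h a (by simp)).le
    | cons b L =>
      refine ⟨List.isChain_cons_cons.2 ⟨?_, ih'.1⟩, by simpa using ih'.2⟩
      refine runIndex_eq_of_forall_notMem hs (hL.1 b (by simp)) fun j => ?_
      rcases hall j with h | h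
      · rcases List.mem_cons.1 h with rfl | h
        · exact Or.inl le_rfl
        · rcases List.mem_cons.1 h with rfl | h
          · exact Or.inr le_rfl
          · exact Or.inr ((List.pairwise_cons.1 hL.2).1 j h).le
      · exact Or.inl (h a (by simp)).le

theorem runIndex_first {s : Fin n → ℕ} (hs : Function.Injective s) {a : Fin n}
    (h : ∀ j, s a ≤ s j) : tailCount (descentSet (config 0 s)) 0 = runIndex 0 s a + 1 := by
  refine tailCount_of_gap (finite_descentSet_config hs) (E := 2 * n) (by omega)
    (fun z _ hz => config_of_forall_ne fun j hj => by have := h j; omega)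
    ((config_lt_iff hs).2 ⟨a, rfl⟩)

theorem isRowList_increasingRuns {s : Fin n → ℕ} (hs : Function.Injective s) :
    IsRowList (runIndex 0 s) (increasingRuns s) ∧
      (increasingRuns s).length = tailCount (descentSet (config 0 s)) 0 := by
  have hp := ballOrder_pairwise hs
  have hmem : ∀ j, j ∈ ballOrder s := fun j =>
    (ballOrder_perm s).mem_iff.2 (List.mem_finRange j)
  obtain ⟨hc, hl⟩ := isChain_runIndex hs (ballOrder s) hp fun j => Or.inl (hmem j)
  have hG : (ballOrder s).splitBy (fun i j => decide (s j = s i + 1 ∧ i < j)) =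
    (increasingRuns s).reverse := by rw [increasingRuns, List.reverse_reverse]
  have hfl : ballOrder s = (increasingRuns s).reverse.flatten := by
    rw [← hG, List.flatten_splitBy]
  obtain ⟨-, h1, h2, h3⟩ := List.splitBy_eq_iff.1 hG
  have key := index_add_length_eq (f := runIndex 0 s) _ h1 h2 h3 (hfl ▸ hc) (hfl ▸ hl)
  rw [List.length_reverse] at key
  have hget : ∀ i g, (increasingRuns s)[i]? = some g → ∀ j ∈ g, runIndex 0 s j = i := by
    intro i g hg j hj
    obtain ⟨hi, -⟩ := List.getElem?_eq_some_iff.1 hg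
    have := key ((increasingRuns s).length - 1 - i) g (by
      rw [List.getElem?_reverse (by omega), ← hg]
      congr 1
      omega) j hj
    omega
  refine ⟨⟨fun g hg => ⟨?_, ?_⟩, fun i j => ⟨?_, ?_⟩⟩, ?_⟩
  · rintro rfl
    exact h1 (List.mem_reverse.2 hg)
  · have := h2 g (List.mem_reverse.2 hg)
    refine (List.isChain_iff_pairwise (R := fun a b : Fin n => a < b)).1 (this.imp fun a b hab => ?_)
    simp only [decide_eq_true_eq] at hab
    exact hab.2
  · rintro ⟨g, hg, hj⟩
    exact hget i g hg j hj
  · rintro rfl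
    have hj := hmem j
    rw [hfl, List.mem_flatten] at hj
    obtain ⟨g, hg, hj⟩ := hj
    obtain ⟨i, hi⟩ := List.mem_iff_getElem?.1 (List.mem_reverse.1 hg)
    rw [hget i g hi j hj]
    exact ⟨g, hi, hj⟩
  · rcases hL : ballOrder s with _ | ⟨a, L⟩
    · have hempty : ∀ j : Fin n, False := fun j => by
        have := hmem j
        rw [hL] at this
        simp at this
      rw [increasingRuns, hL, tailCount_eq_zero]
      · simp
      · intro z _
        rw [mem_descentSet, config_of_forall_ne fun j => (hempty j).elim,
          config_of_forall_ne fun j => (hempty j).elim]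
        exact lt_irrefl _
    · have hfirst : ∀ j, s a ≤ s j := fun j => by
        have hj := hmem j
        rw [hL] at hj hp
        rcases List.mem_cons.1 hj with rfl | hj
        · exact le_rfl
        · exact ((List.pairwise_cons.1 hp).1 j hj).le
      rw [runIndex_first hs hfirst]
      rcases hR : (increasingRuns s).reverse with _ | ⟨g, G⟩
      · rw [hfl, hR] at hL
        simp at hL
      · have hg : g ≠ [] := by
          rintro rfl
          rw [hR] at h1
          simp at h1
        have ha : a ∈ g := by
          rw [hfl, hR, List.flatten_cons] at hL
          obtain ⟨b, g', rfl⟩ := List.exists_cons_of_ne_nil hg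
          simp only [List.cons_append, List.cons.injEq] at hL
          simp [hL.1]
        have := key 0 g (by rw [hR]; rfl) a ha
        omega

theorem isSteadyState_of_isLimitIndex {s f : Fin n → ℕ} {T : ℕ} (hs : Function.Injective s)
    (h : IsLimitIndex s f T) : IsSteadyState (bbsMove^[T] s) := by
  have hrow : ∀ t, IsRowList f (increasingRuns (bbsMove^[T + t] s)) := fun t => by
    rw [← h (T + t) (by omega)]
    exact (isRowList_increasingRuns (bbsMove_iterate_injective hs _)).1
  refine ⟨fun t => ?_, ?_⟩
  · rw [← Function.iterate_add_apply, add_comm t T]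
    exact (hrow t).unique (hrow 0)
  · have h0 : IsRowList f (increasingRuns (bbsMove^[T] s)) := hrow 0
    rw [List.pairwise_map, List.pairwise_iff_getElem]
    intro i j hi hj hij
    rw [h0.length_eq (List.getElem?_eq_getElem hi), h0.length_eq (List.getElem?_eq_getElem hj)]
    exact h.rowSize_antitone hs hij.le

end Runs

/-! ### Insertion tableaux are standard -/

section Tableau

variable {α : Type*} [LinearOrder α]

theorem rowInsert_cases (x : α) (R : List α) :
    (rowInsert x R = (R ++ [x], none) ∧ ∀ a ∈ R, a ≤ x) ∨
      ∃ A y B, R = A ++ y :: B ∧ rowInsert x R = (A ++ x :: B, some y) ∧ x < y ∧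
        ∀ a ∈ A, a ≤ x := by
  induction R with
  | nil => exact Or.inl ⟨rfl, by simp⟩
  | cons b R ih =>
    by_cases hb : x < b
    · exact Or.inr ⟨[], b, R, rfl, by simp [rowInsert, hb], hb, by simp⟩
    · rcases ih with ⟨h1, h2⟩ | ⟨A, y, B, h1, h2, h3, h4⟩
      · refine Or.inl ⟨by simp [rowInsert, hb, h1], fun a ha => ?_⟩
        rcases List.mem_cons.1 ha with rfl | ha
        · exact not_lt.1 hb
        · exact h2 a ha
      · refine Or.inr ⟨b :: A, y, B, by simp [h1], by simp [rowInsert, hb, h2], h3, fun a ha => ?_⟩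
        rcases List.mem_cons.1 ha with rfl | ha
        · exact not_lt.1 hb
        · exact h4 a ha

/-- The rows `R` and `R'`, with `R'` below `R`, have strictly increasing columns. -/
def RowDominates (R R' : List α) : Prop :=
  ∀ m, R'.countP (fun a => decide (a ≤ m)) ≤ R.countP fun a => decide (a < m)

/-- The list of rows `T` is a tableau. -/
structure IsTableau (T : List (List α)) : Prop where
  ne_nil : ∀ R ∈ T, R ≠ []
  sorted : ∀ R ∈ T, R.Pairwise (· ≤ ·)
  columns : T.IsChain RowDominates

theorem pairwise_replace {A B : List α} {x y : α} (h : (A ++ y :: B).Pairwise (· ≤ ·)) (hxy : x < y)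
    (hA : ∀ a ∈ A, a ≤ x) : (A ++ x :: B).Pairwise (· ≤ ·) := by
  rw [List.pairwise_append, List.pairwise_cons] at h ⊢
  refine ⟨h.1, ⟨fun b hb => hxy.le.trans (h.2.1.1 b hb), h.2.1.2⟩, fun a ha b hb => ?_⟩
  rcases List.mem_cons.1 hb with rfl | hb
  · exact hA a ha
  · exact h.2.2 a ha b (List.mem_cons_of_mem _ hb)

theorem rowInsert_sorted {R : List α} (h : R.Pairwise (· ≤ ·)) (x : α) :
    (rowInsert x R).1.Pairwise (· ≤ ·) := by
  rcases rowInsert_cases x R with ⟨h1, h2⟩ | ⟨A, y, B, rfl, h2, h3, h4⟩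
  · rw [h1, List.pairwise_append]
    refine ⟨h, by simp, fun a ha b hb => ?_⟩
    obtain rfl : b = x := by simpa using hb
    exact h2 a ha
  · rw [h2]
    exact pairwise_replace h h3 h4

theorem RowDominates.append {R R' : List α} (h : RowDominates R R') (x : α) :
    RowDominates (R ++ [x]) R' := fun m => (h m).trans (by rw [List.countP_append]; omega)

/-- At most as many entries of `R'` are `≤ y` as there are entries of `R` to the left of `y`. So `y`
enters the lower row no further right than the column where `x` has replaced it. -/
theorem RowDominates.rowInsert {A B R' : List α} {x y : α} (hR : (A ++ y :: B).Pairwise (· ≤ ·))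
    (hR' : R'.Pairwise (· ≤ ·)) (h : RowDominates (A ++ y :: B) R') (hxy : x < y)
    (hA : ∀ a ∈ A, a ≤ x) : RowDominates (A ++ x :: B) (rowInsert y R').1 := by
  have hB : ∀ b ∈ B, y ≤ b := (List.pairwise_cons.1 (List.pairwise_append.1 hR).2.1).1
  have hAcount : ∀ m, y ≤ m → A.countP (fun a => decide (a < m)) = A.length := fun m hm => by
    rw [List.countP_eq_length]
    intro a ha
    simpa using ((hA a ha).trans_lt hxy).trans_le hm
  have hBcount : B.countP (fun a => decide (a < y)) = 0 := by
    rw [List.countP_eq_zero]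
    intro b hb
    simpa using hB b hb
  -- The domination at the bumped entry bounds its new column.
  have hy := h y
  simp only [List.countP_append, List.countP_cons, hAcount y le_rfl, hBcount, lt_irrefl,
    decide_false, Bool.false_eq_true, if_false, add_zero] at hy
  intro m
  have hm := h m
  simp only [List.countP_append, List.countP_cons, decide_eq_true_eq] at hm ⊢
  rcases rowInsert_cases y R' with ⟨h1, h2⟩ | ⟨A', z, B', rfl, h2, h3, h4⟩
  · simp only [h1, List.countP_append, List.countP_singleton, decide_eq_true_eq]
    rcases lt_or_ge m y with hmy | hmy
    · rw [if_neg (not_le.2 hmy)]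
      rw [if_neg (not_lt.2 hmy.le)] at hm
      omega
    · rw [if_pos hmy, if_pos (hxy.trans_le hmy), hAcount m hmy]
      have h5 : R'.countP (fun a => decide (a ≤ y)) = R'.length := by
        rw [List.countP_eq_length]
        intro a ha
        simpa using h2 a ha
      have h6 := List.countP_le_length (p := fun a => decide (a ≤ m)) (l := R')
      omega
  · simp only [h2, List.countP_append, List.countP_cons, decide_eq_true_eq]
    simp only [List.countP_append, List.countP_cons, decide_eq_true_eq] at hm hy
    rcases lt_or_ge m y with hmy | hmy
    · rw [if_neg (not_le.2 hmy)]
      rw [if_neg (not_lt.2 hmy.le)] at hm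
      omega
    · rw [if_pos hmy, if_pos (hxy.trans_le hmy), hAcount m hmy]
      rcases lt_or_ge m z with hmz | hmz
      · have hB' : B'.countP (fun a => decide (a ≤ m)) = 0 := by
          rw [List.countP_eq_zero]
          intro b hb
          have := (List.pairwise_cons.1 (List.pairwise_append.1 hR').2.1).1 b hb
          simpa using hmz.trans_le this
        have hA' : A'.countP (fun a => decide (a ≤ y)) = A'.length := by
          rw [List.countP_eq_length]
          intro a ha
          simpa using h4 a ha
        have h6 := List.countP_le_length (p := fun a => decide (a ≤ m)) (l := A')
        omega
      · rw [if_pos hmz, hAcount m hmy] at hm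
        split_ifs at hm <;> omega

theorem rsInsert_head? (x : α) (T : List (List α)) :
    (rsInsert x T).head? = some (rowInsert x (T.headD [])).1 := by
  cases T with
  | nil => rfl
  | cons R T =>
    rcases rowInsert_cases x R with ⟨h1, -⟩ | ⟨A, y, B, -, h2, -⟩
    · simp [rsInsert, h1]
    · simp [rsInsert, h2]

theorem IsTableau.rsInsert {T : List (List α)} (h : IsTableau T) (x : α) :
    IsTableau (rsInsert x T) := by
  induction T generalizing x with
  | nil => exact ⟨by simp [_root_.rsInsert], by simp [_root_.rsInsert], by simp [_root_.rsInsert]⟩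
  | cons R T ih =>
    obtain ⟨h1, h2, h3⟩ := h
    rw [List.isChain_cons] at h3
    have hT : IsTableau T := ⟨fun R' hR' => h1 R' (List.mem_cons_of_mem _ hR'),
      fun R' hR' => h2 R' (List.mem_cons_of_mem _ hR'), h3.2⟩
    have hR := h2 R List.mem_cons_self
    rcases rowInsert_cases x R with ⟨e1, e2⟩ | ⟨A, y, B, rfl, e2, e3, e4⟩
    · have : _root_.rsInsert x (R :: T) = (R ++ [x]) :: T := by simp [_root_.rsInsert, e1]
      rw [this]
      refine ⟨fun R' hR' => ?_, fun R' hR' => ?_, ?_⟩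
      · rcases List.mem_cons.1 hR' with rfl | hR'
        · simp
        · exact hT.ne_nil R' hR'
      · rcases List.mem_cons.1 hR' with rfl | hR'
        · have := rowInsert_sorted hR x
          rwa [e1] at this
        · exact hT.sorted R' hR'
      · rw [List.isChain_cons]
        exact ⟨fun R' hR' => (h3.1 R' hR').append x, h3.2⟩
    · have : _root_.rsInsert x ((A ++ y :: B) :: T) = (A ++ x :: B) :: _root_.rsInsert y T := by
        simp [_root_.rsInsert, e2]
      rw [this]
      have hT' := ih hT y
      refine ⟨fun R' hR' => ?_, fun R' hR' => ?_, ?_⟩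
      · rcases List.mem_cons.1 hR' with rfl | hR'
        · simp
        · exact hT'.ne_nil R' hR'
      · rcases List.mem_cons.1 hR' with rfl | hR'
        · exact pairwise_replace hR e3 e4
        · exact hT'.sorted R' hR'
      · rw [List.isChain_cons]
        refine ⟨fun R' hR' => ?_, hT'.columns⟩
        rw [rsInsert_head?, Option.mem_some_iff] at hR'
        rw [← hR']
        cases T with
        | nil => exact RowDominates.rowInsert hR (by simp) (fun m => by simp) e3 e4
        | cons R₁ T =>
          exact RowDominates.rowInsert hR (hT.sorted R₁ List.mem_cons_self) (h3.1 R₁ (by simp)) e3 e4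

theorem rsInsert_flatten_perm (x : α) (T : List (List α)) :
    (rsInsert x T).flatten.Perm (x :: T.flatten) := by
  induction T generalizing x with
  | nil => simp [rsInsert]
  | cons R T ih =>
    rcases rowInsert_cases x R with ⟨e1, -⟩ | ⟨A, y, B, rfl, e2, -⟩
    · have : rsInsert x (R :: T) = (R ++ [x]) :: T := by simp [rsInsert, e1]
      rw [this, List.flatten_cons, List.flatten_cons, List.append_assoc, List.singleton_append]
      exact List.perm_middle
    · have : rsInsert x ((A ++ y :: B) :: T) = (A ++ x :: B) :: rsInsert y T := by
        simp [rsInsert, e2]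
      rw [this, List.flatten_cons, List.flatten_cons]
      have h1 := (ih y).append_left (A ++ x :: B)
      refine h1.trans ?_
      simp only [List.append_assoc, List.cons_append]
      refine List.perm_middle.trans (List.Perm.cons _ (List.Perm.append_left _ ?_))
      exact List.perm_middle

theorem isTableau_insertionTableau (u : List α) :
    IsTableau (insertionTableau u) ∧ (insertionTableau u).flatten.Perm u := by
  have key : ∀ T : List (List α), IsTableau T →
      IsTableau (u.foldl (fun T x => rsInsert x T) T) ∧
        (u.foldl (fun T x => rsInsert x T) T).flatten.Perm (u ++ T.flatten) := by
    induction u with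
    | nil => exact fun T hT => ⟨hT, by simp⟩
    | cons x u ih =>
      intro T hT
      obtain ⟨h1, h2⟩ := ih (rsInsert x T) (hT.rsInsert x)
      refine ⟨h1, h2.trans ?_⟩
      exact ((rsInsert_flatten_perm x T).append_left u).trans List.perm_middle
  simpa [insertionTableau] using key [] ⟨by simp, by simp, by simp⟩

end Tableau

/-! ### The box-ball system of a row reading word -/

section ReadingWord

variable {n : ℕ}

theorem rowReadingWord_perm {α : Type*} (T : List (List α)) : (rowReadingWord T).Perm T.flatten :=
  (List.reverse_perm T).flatten

theorem initialState_apply (w : Equiv.Perm (Fin n)) (b : Fin n) : initialState w (w b) = b := by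
  simp [initialState]

theorem initialState_injective (w : Equiv.Perm (Fin n)) : Function.Injective (initialState w) :=
  fun _ _ h => w.symm.injective (Fin.ext h)

theorem oneLine_perm (w : Equiv.Perm (Fin n)) : (oneLine w).Perm (List.finRange n) := by
  refine (List.perm_ext_iff_of_nodup ?_ (List.nodup_finRange n)).2 fun a => ?_
  · exact List.nodup_ofFn.2 w.injective
  · simp only [List.mem_finRange, iff_true, oneLine, List.mem_ofFn]
    exact ⟨w.symm a, by simp⟩

theorem exists_oneLine_eq {L : List (Fin n)} (h : L.Perm (List.finRange n)) :
    ∃ w : Equiv.Perm (Fin n), oneLine w = L := by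
  have hlen : L.length = n := by rw [h.length_eq, List.length_finRange]
  have hnd : L.Nodup := h.nodup_iff.2 (List.nodup_finRange n)
  have hinj : Function.Injective fun i : Fin n => L.get (i.cast hlen.symm) := fun i j hij => by
    have := List.nodup_iff_injective_get.1 hnd hij
    simpa [Fin.ext_iff] using this
  refine ⟨Equiv.ofBijective _ (Finite.injective_iff_bijective.1 hinj), ?_⟩
  rw [oneLine]
  refine List.ext_getElem (by simp [hlen]) fun i h1 h2 => ?_
  simp

theorem ballOrder_initialState (w : Equiv.Perm (Fin n)) : ballOrder (initialState w) = oneLine w := by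
  refine ballOrder_eq (oneLine_perm w) ?_ (initialState_injective w)
  rw [oneLine, List.pairwise_ofFn]
  intro i j hij
  rw [initialState_apply, initialState_apply]
  exact hij

theorem increasingRuns_initialState {w : Equiv.Perm (Fin n)} {T : List (List (Fin n))}
    (hT : IsTableau T) (hw : oneLine w = rowReadingWord T) :
    increasingRuns (initialState w) = T := by
  have hnd : ∀ R ∈ T, R.Nodup := by
    have : T.flatten.Nodup := (rowReadingWord_perm T).nodup_iff.1
      (hw ▸ (oneLine_perm w).nodup_iff.2 (List.nodup_finRange n))
    exact (List.nodup_flatten.1 this).1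
  have hne : [] ∉ T.reverse := fun h => hT.ne_nil [] (List.mem_reverse.1 h) rfl
  have hchain : T.reverse.flatten.IsChain
      fun i j => initialState w j = initialState w i + 1 := by
    change (rowReadingWord T).IsChain _
    rw [← hw, oneLine, List.isChain_iff_getElem]
    intro i hi
    rw [List.getElem_ofFn, List.getElem_ofFn, initialState_apply, initialState_apply]
  rw [increasingRuns, ballOrder_initialState, hw, List.reverse_eq_iff, List.splitBy_eq_iff]
  refine ⟨rfl, hne, fun R hR => ?_, ?_⟩
  · have h1 := ((List.isChain_flatten hne).1 hchain).1 R hR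
    have h2 := hT.sorted R (List.mem_reverse.1 hR)
    have h3 : R.Pairwise (· < ·) :=
      h2.imp₂ (fun a b hab hne => lt_of_le_of_ne hab hne) (hnd R (List.mem_reverse.1 hR))
    rw [List.isChain_iff_getElem] at h1 ⊢
    intro i hi
    rw [decide_eq_true_eq]
    exact ⟨h1 i hi, List.pairwise_iff_getElem.1 h3 _ _ _ _ (Nat.lt_succ_self i)⟩
  · rw [List.isChain_reverse, List.isChain_iff_getElem]
    intro i hi
    have h1 := hT.ne_nil _ (List.getElem_mem hi)
    have h2 := hT.ne_nil _ (List.getElem_mem (Nat.lt_of_succ_lt hi))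
    refine ⟨h1, h2, ?_⟩
    rw [decide_eq_false_iff_not, not_and, not_lt]
    intro _
    -- Domination at the last entry of the lower row yields a smaller entry in the row above, so the
    -- word cannot continue increasing from the lower row into the upper one.
    have h3 := List.isChain_iff_getElem.1 hT.columns i hi (T[i + 1].getLast h1)
    have h4 : 0 < T[i + 1].countP fun a => decide (a ≤ T[i + 1].getLast h1) :=
      List.countP_pos_iff.2 ⟨_, List.getLast_mem h1, by simp⟩
    obtain ⟨a, ha, ha'⟩ := List.countP_pos_iff.1 (h4.trans_le h3)
    rw [decide_eq_true_eq] at ha'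
    refine le_trans ?_ ha'.le
    have h5 := hT.sorted _ (List.getElem_mem (Nat.lt_of_succ_lt hi))
    revert ha h5
    generalize hL : T[i] = L at h2 ⊢
    cases L with
    | nil => exact absurd rfl h2
    | cons b L =>
      intro ha h5
      rcases List.mem_cons.1 ha with rfl | ha
      · exact le_rfl
      · exact (List.pairwise_cons.1 h5).1 a ha

theorem IsRowList.card_filter {f : Fin n → ℕ} {G : List (List (Fin n))} (h : IsRowList f G) {i : ℕ}
    {g : List (Fin n)} (hg : G[i]? = some g) (p : Fin n → Prop) [DecidablePred p] :
    (Finset.univ.filter fun j => f j = i ∧ p j).card = g.countP fun j => decide (p j) := by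
  have hnd : g.Nodup := (h.1 g (List.mem_of_getElem? hg)).2.imp fun hab => hab.ne
  rw [List.countP_eq_length_filter, ← List.toFinset_card_of_nodup (hnd.filter _)]
  congr 1
  ext j
  simp [h.mem_iff hg]

theorem IsRowList.columnStrict {f : Fin n → ℕ} {T : List (List (Fin n))} (h : IsRowList f T)
    (hT : IsTableau T) : ColumnStrict f := by
  intro k m
  by_cases hk : k + 1 < T.length
  · rw [h.card_filter (List.getElem?_eq_getElem hk),
      h.card_filter (List.getElem?_eq_getElem (Nat.lt_of_succ_lt hk))]
    exact List.isChain_iff_getElem.1 hT.columns k hk m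
  · have : (Finset.univ.filter fun j => f j = k + 1 ∧ j ≤ m) = ∅ := by
      refine Finset.filter_eq_empty_iff.2 fun j _ hj => ?_
      obtain ⟨g, hg, -⟩ := (h.2 (k + 1) j).2 hj.1
      rw [List.getElem?_eq_none (by omega)] at hg
      exact absurd hg (by simp)
    rw [this, Finset.card_empty]
    exact Nat.zero_le _

/-- The state of a row reading word of a tableau is steady from the beginning on. -/
theorem isLimitIndex_rowReadingWord {w : Equiv.Perm (Fin n)} {T : List (List (Fin n))}
    (hT : IsTableau T) (hw : oneLine w = rowReadingWord T) :
    IsRowList (runIndex 0 (initialState w)) T ∧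
      IsLimitIndex (initialState w) (runIndex 0 (initialState w)) 0 := by
  have h := (isRowList_increasingRuns (initialState_injective w)).1
  rw [increasingRuns_initialState hT hw] at h
  exact ⟨h, isLimitIndex_of_columnStrict (initialState_injective w) (h.columnStrict hT)⟩

end ReadingWord

/-! ### Knuth moves on permutations -/

section KnuthPaths

variable {n : ℕ} {w w' : Equiv.Perm (Fin n)}

theorem oneLine_nodup (w : Equiv.Perm (Fin n)) : (oneLine w).Nodup :=
  (oneLine_perm w).nodup_iff.2 (List.nodup_finRange n)

/-- The sequence of labels of the initial state of a permutation. -/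
noncomputable def permConfig (w : Equiv.Perm (Fin n)) : ℕ → ℕ := config 0 (initialState w)

/-- The default `2 * n` is the label of an empty box, which is what lies beyond the word. -/
theorem permConfig_succ (w : Equiv.Perm (Fin n)) (p : ℕ) :
    permConfig w (p + 1) = ((oneLine w)[p]?.map Fin.val).getD (2 * n) := by
  by_cases hp : p < n
  · have h1 : (oneLine w)[p]? = some (w ⟨p, hp⟩) := by simp [oneLine, hp]
    have h2 := config_ball (i := 0) (initialState_injective w) (w ⟨p, hp⟩)
    rw [initialState_apply] at h2
    rw [h1, permConfig, h2]
    simp [ballLabel]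
  · have h1 : (oneLine w)[p]? = none := by simp [oneLine, hp]
    rw [h1, permConfig, config_of_forall_ne]
    · rfl
    · intro j
      have : initialState w j < n := (w.symm j).isLt
      omega

theorem permConfig_zero (w : Equiv.Perm (Fin n)) : permConfig w 0 = 2 * n := config_zero

theorem permConfig_length_append {a b : List (Fin n)} (h : oneLine w = a ++ b) :
    permConfig w a.length = (a.getLast?.map Fin.val).getD (2 * n) := by
  rcases List.eq_nil_or_concat a with rfl | ⟨a, c, rfl⟩
  · exact permConfig_zero w
  · rw [List.length_concat, permConfig_succ, h]
    simp

/-- The permutation `w'` is obtained from `w` by exchanging the adjacent entries `p < q`, which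
are preceded by `a` and followed by `b`. -/
def AscentSwap (w w' : Equiv.Perm (Fin n)) (a : List (Fin n)) (p q : Fin n) (b : List (Fin n)) :
    Prop :=
  p < q ∧ oneLine w = a ++ p :: q :: b ∧ oneLine w' = a ++ q :: p :: b

/-- The entry preceding position `i` lies between the following two entries. -/
def LeftBetween (X : ℕ → ℕ) (i : ℕ) : Prop := X (i + 1) < X i ∧ X i ≤ X (i + 2)

/-- The entry following position `i + 2` lies between the preceding two entries. -/
def RightBetween (X : ℕ → ℕ) (i : ℕ) : Prop := X (i + 1) ≤ X (i + 3) ∧ X (i + 3) < X (i + 2)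

variable {a b : List (Fin n)} {p q : Fin n}

theorem AscentSwap.apply (h : AscentSwap w w' a p q b) :
    permConfig w (a.length + 1) = p ∧ permConfig w (a.length + 2) = q ∧
      permConfig w (a.length + 3) = (b.head?.map Fin.val).getD (2 * n) := by
  obtain ⟨-, h1, -⟩ := h
  refine ⟨?_, ?_, ?_⟩
  · rw [permConfig_succ, h1]; simp
  · rw [permConfig_succ, h1]; simp
  · rw [permConfig_succ, h1, List.getElem?_append_right (by omega)]
    simp [List.head?_eq_getElem?]

theorem AscentSwap.isSwap (h : AscentSwap w w' a p q b) :
    IsSwap (permConfig w) (permConfig w') a.length := by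
  obtain ⟨e1, e2, -⟩ := h.apply
  obtain ⟨h1, h2, h3⟩ := h
  refine ⟨by rw [e1, e2]; exact h1, ?_, ?_, fun x hx1 hx2 => ?_⟩
  · rw [e2, permConfig_succ, h3]; simp
  · rw [e1, permConfig_succ, h3]; simp
  · cases x with
    | zero => rw [permConfig_zero, permConfig_zero]
    | succ x =>
      rw [permConfig_succ, permConfig_succ, h2, h3]
      rcases lt_or_ge x a.length with hx | hx
      · rw [List.getElem?_append_left hx, List.getElem?_append_left hx]
      · rw [List.getElem?_append_right hx, List.getElem?_append_right hx]
        obtain ⟨y, hy⟩ : ∃ y, x - a.length = y + 2 := ⟨x - a.length - 2, by omega⟩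
        rw [hy]
        rfl

theorem AscentSwap.knuthOne (h : AscentSwap w w' a p q b)
    (hl : LeftBetween (permConfig w) a.length) :
    KnuthOne (oneLine w) (oneLine w') ∧ KnuthOne (oneLine w') (oneLine w) := by
  obtain ⟨e1, e2, -⟩ := h.apply
  obtain ⟨h1, h2, h3⟩ := h
  rw [LeftBetween, e1, e2, permConfig_length_append h2] at hl
  -- With an empty prefix the left neighbour is an empty box, too large to lie between.
  rcases List.eq_nil_or_concat a with rfl | ⟨a, c, rfl⟩
  · simp at hl
    omega
  · simp at hl
    have hcq : c ≠ q := by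
      rintro rfl
      have := oneLine_nodup w
      rw [h2] at this
      simp [List.nodup_append] at this
    have hcq' : c < q := lt_of_le_of_ne hl.2 hcq
    exact ⟨⟨a, b, p, c, q, hl.1, hcq', Or.inl ⟨by simp [h2], by simp [h3]⟩⟩,
      ⟨a, b, p, c, q, hl.1, hcq', Or.inr ⟨by simp [h2], by simp [h3]⟩⟩⟩

theorem AscentSwap.knuthTwo (h : AscentSwap w w' a p q b)
    (hr : RightBetween (permConfig w) a.length) :
    KnuthTwo (oneLine w) (oneLine w') ∧ KnuthTwo (oneLine w') (oneLine w) := by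
  obtain ⟨e1, e2, e3⟩ := h.apply
  obtain ⟨h1, h2, h3⟩ := h
  rw [RightBetween, e1, e2, e3] at hr
  cases b with
  | nil =>
    simp at hr
    omega
  | cons c b =>
    simp at hr
    have hpc : p ≠ c := by
      rintro rfl
      have := oneLine_nodup w
      rw [h2] at this
      simp [List.nodup_append] at this
    have hpc' : p < c := lt_of_le_of_ne hr.1 hpc
    exact ⟨⟨a, b, p, c, q, hpc', hr.2, Or.inl ⟨by simp [h2], by simp [h3]⟩⟩,
      ⟨a, b, p, c, q, hpc', hr.2, Or.inr ⟨by simp [h2], by simp [h3]⟩⟩⟩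

theorem exists_ascentSwap_of_knuthOne (h : KnuthOne (oneLine w) (oneLine w')) :
    ∃ a p q b, (AscentSwap w w' a p q b ∧ LeftBetween (permConfig w) a.length) ∨
      (AscentSwap w' w a p q b ∧ LeftBetween (permConfig w') a.length) := by
  have key : ∀ {w w' : Equiv.Perm (Fin n)} {a b : List (Fin n)} {x y z : Fin n}, x < y → y < z →
      oneLine w = a ++ [y, x, z] ++ b → oneLine w' = a ++ [y, z, x] ++ b →
      AscentSwap w w' (a ++ [y]) x z b ∧ LeftBetween (permConfig w) (a ++ [y]).length := by
    intro w w' a b x y z hxy hyz h1 h2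
    have h : AscentSwap w w' (a ++ [y]) x z b := ⟨hxy.trans hyz, by simp [h1], by simp [h2]⟩
    obtain ⟨e1, e2, -⟩ := h.apply
    refine ⟨h, ?_⟩
    rw [LeftBetween, e1, e2, permConfig_length_append h.2.1]
    simpa using ⟨hxy, hyz.le⟩
  obtain ⟨a, b, x, y, z, hxy, hyz, ⟨h1, h2⟩ | ⟨h1, h2⟩⟩ := h
  · exact ⟨_, _, _, _, Or.inl (key hxy hyz h1 h2)⟩
  · exact ⟨_, _, _, _, Or.inr (key hxy hyz h1 h2)⟩

theorem exists_ascentSwap_of_knuthTwo (h : KnuthTwo (oneLine w) (oneLine w')) :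
    ∃ a p q b, (AscentSwap w w' a p q b ∧ RightBetween (permConfig w) a.length) ∨
      (AscentSwap w' w a p q b ∧ RightBetween (permConfig w') a.length) := by
  have key : ∀ {w w' : Equiv.Perm (Fin n)} {a b : List (Fin n)} {x y z : Fin n}, x < y → y < z →
      oneLine w = a ++ [x, z, y] ++ b → oneLine w' = a ++ [z, x, y] ++ b →
      AscentSwap w w' a x z (y :: b) ∧ RightBetween (permConfig w) a.length := by
    intro w w' a b x y z hxy hyz h1 h2
    have h : AscentSwap w w' a x z (y :: b) := ⟨hxy.trans hyz, by simp [h1], by simp [h2]⟩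
    obtain ⟨e1, e2, e3⟩ := h.apply
    refine ⟨h, ?_⟩
    rw [RightBetween, e1, e2, e3]
    simpa using ⟨hxy.le, hyz⟩
  obtain ⟨a, b, x, y, z, hxy, hyz, ⟨h1, h2⟩ | ⟨h1, h2⟩⟩ := h
  · exact ⟨_, _, _, _, Or.inl (key hxy hyz h1 h2)⟩
  · exact ⟨_, _, _, _, Or.inr (key hxy hyz h1 h2)⟩

/-- One neighbour lies between because the move is a Knuth move; if both did, it would be a `K_B`
move. -/
theorem properlyAdjacent_of_knuthMove (h : KnuthMove (oneLine w) (oneLine w'))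
    (hB : ¬ KnuthBoth (oneLine w) (oneLine w')) :
    ProperlyAdjacent 0 (initialState w) (initialState w') := by
  have key : ∀ {w w' : Equiv.Perm (Fin n)} {a p q b}, AscentSwap w w' a p q b →
      (LeftBetween (permConfig w) a.length ↔ ¬ RightBetween (permConfig w) a.length) →
      IsProperSwap (config 0 (initialState w)) (config 0 (initialState w')) a.length :=
    fun h1 h2 => ⟨h1.isSwap, h2⟩
  rcases h with h | h
  · obtain ⟨a, p, q, b, ⟨h1, h2⟩ | ⟨h1, h2⟩⟩ := exists_ascentSwap_of_knuthOne h
    · exact ⟨_, Or.inl (key h1 ⟨fun _ h3 => hB ⟨h, (h1.knuthTwo h3).1⟩, fun _ => h2⟩)⟩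
    · exact ⟨_, Or.inr (key h1 ⟨fun _ h3 => hB ⟨h, (h1.knuthTwo h3).2⟩, fun _ => h2⟩)⟩
  · obtain ⟨a, p, q, b, ⟨h1, h2⟩ | ⟨h1, h2⟩⟩ := exists_ascentSwap_of_knuthTwo h
    · exact ⟨_, Or.inl (key h1 ⟨fun h3 => (hB ⟨(h1.knuthOne h3).1, h⟩).elim,
        fun h3 => (h3 h2).elim⟩)⟩
    · exact ⟨_, Or.inr (key h1 ⟨fun h3 => (hB ⟨(h1.knuthOne h3).2, h⟩).elim,
        fun h3 => (h3 h2).elim⟩)⟩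

/-- A `K_B` move comes with separate witnesses of both kinds. This lemma and `IsSwap.not_symm` show
that they describe the same exchange. -/
theorem IsSwap.index_unique {X Y : ℕ → ℕ} {i j : ℕ} (h : IsSwap X Y i) (h' : IsSwap X Y j) :
    i = j := by
  have h1 := h.lt
  have h2 := h.left
  have h3 := h.right
  by_contra hij
  by_cases hj : i + 1 = j + 2
  · have h4 := h'.lt
    have h5 := h'.right
    rw [← hj] at h4 h5
    omega
  · have := h'.other (i + 1) (by omega) hj
    omega

theorem IsSwap.not_symm {X Y : ℕ → ℕ} {i j : ℕ} (h : IsSwap X Y i) : ¬ IsSwap Y X j := by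
  intro h'
  have h1 := h.lt
  have h2 := h.left
  have h3 := h.right
  have k1 := h'.lt
  have k2 := h'.left
  have k3 := h'.right
  by_cases hj : i + 1 = j + 1
  · obtain rfl : i = j := by omega
    omega
  · by_cases hj' : i + 1 = j + 2
    · have := h'.other (i + 2) (by omega) (by omega)
      omega
    · have := h'.other (i + 1) hj hj'
      omega

/-- With both neighbours in between, the descents at `i` and `i + 2` are replaced by a single one at
`i + 1`. -/
theorem IsSwap.tailCount_zero {X Y : ℕ → ℕ} {i : ℕ} (h : IsSwap X Y i) (hl : LeftBetween X i)
    (hr : RightBetween X i) (hX : (descentSet X).Finite) (hY : (descentSet Y).Finite) :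
    tailCount (descentSet X) 0 = tailCount (descentSet Y) 0 + 1 := by
  obtain ⟨h1, h2, h3, h4⟩ := h
  obtain ⟨l1, l2⟩ := hl
  obtain ⟨r1, r2⟩ := hr
  have e0 := h4 i (by omega) (by omega)
  have e3 := h4 (i + 3) (by omega) (by omega)
  have hiff : ∀ y, y ≠ i → y ≠ i + 1 → y ≠ i + 2 → (y ∈ descentSet X ↔ y ∈ descentSet Y) := by
    intro y y1 y2 y3
    rw [mem_descentSet, mem_descentSet, h4 y y2 y3, h4 (y + 1) (by omega) (by omega)]
  have x0 : i ∈ descentSet X := by rw [mem_descentSet]; omega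
  have x1 : i + 1 ∉ descentSet X := by
    rw [mem_descentSet]; change ¬ X (i + 2) < X (i + 1); omega
  have x2 : i + 2 ∈ descentSet X := by
    rw [mem_descentSet]; change X (i + 3) < X (i + 2); omega
  have y0 : i ∉ descentSet Y := by rw [mem_descentSet]; omega
  have y1 : i + 1 ∈ descentSet Y := by
    rw [mem_descentSet]; change Y (i + 2) < Y (i + 1); omega
  have y2 : i + 2 ∉ descentSet Y := by
    rw [mem_descentSet]; change ¬ Y (i + 3) < Y (i + 2); omega
  refine tailCount_add_congr hY hX (x := i) (a := 0) (b := 1) ?_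
    (fun y hy => hiff y (by omega) (by omega) (by omega)) (by omega)
  rw [tailCount_of_mem hX x0, tailCount_of_notMem x1, tailCount_of_mem hX x2,
    tailCount_of_notMem y0, tailCount_of_mem hY y1, tailCount_of_notMem y2,
    tailCount_congr fun y hy => hiff y (by omega) (by omega) (by omega)]

/-- The number of increasing runs of the initial state of `w`. -/
noncomputable def permRuns (w : Equiv.Perm (Fin n)) : ℕ := tailCount (descentSet (permConfig w)) 0

theorem permRuns_of_knuthBoth (h : KnuthBoth (oneLine w) (oneLine w')) :
    permRuns w = permRuns w' + 1 ∨ permRuns w' = permRuns w + 1 := by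
  have hD : ∀ w : Equiv.Perm (Fin n), (descentSet (permConfig w)).Finite := fun w =>
    finite_descentSet_config (initialState_injective w)
  obtain ⟨a, p, q, b, ⟨h1, h2⟩ | ⟨h1, h2⟩⟩ := exists_ascentSwap_of_knuthOne h.1 <;>
    obtain ⟨a', p', q', b', ⟨h3, h4⟩ | ⟨h3, h4⟩⟩ := exists_ascentSwap_of_knuthTwo h.2
  · rw [← h1.isSwap.index_unique h3.isSwap] at h4
    exact Or.inl (h1.isSwap.tailCount_zero h2 h4 (hD w) (hD w'))
  · exact (h1.isSwap.not_symm h3.isSwap).elim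
  · exact (h1.isSwap.not_symm h3.isSwap).elim
  · rw [← h1.isSwap.index_unique h3.isSwap] at h4
    exact Or.inr (h1.isSwap.tailCount_zero h2 h4 (hD w') (hD w))

theorem KnuthMove.perm {α : Type*} [LinearOrder α] {u v : List α} (h : KnuthMove u v) :
    u.Perm v := by
  rcases h with ⟨a, b, x, y, z, -, -, h⟩ | ⟨a, b, x, y, z, -, -, h⟩
  · have : (a ++ [y, x, z] ++ b).Perm (a ++ [y, z, x] ++ b) :=
      ((List.Perm.cons y (List.Perm.swap z x [])).append_left a).append_right b
    rcases h with ⟨rfl, rfl⟩ | ⟨rfl, rfl⟩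
    · exact this
    · exact this.symm
  · have : (a ++ [x, z, y] ++ b).Perm (a ++ [z, x, y] ++ b) :=
      ((List.Perm.swap z x [y]).append_left a).append_right b
    rcases h with ⟨rfl, rfl⟩ | ⟨rfl, rfl⟩
    · exact this
    · exact this.symm

theorem KnuthPath.exists_oneLine_eq {v : List (Fin n)} (h : v.Perm (oneLine w)) :
    ∃ w₁ : Equiv.Perm (Fin n), oneLine w₁ = v :=
  _root_.exists_oneLine_eq (h.trans (oneLine_perm w))

theorem KnuthPath.permRuns_parity {k : ℕ} {u v : List (Fin n)} (h : KnuthPath k u v)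
    (hu : u = oneLine w) (hv : v = oneLine w') : (permRuns w' + k) % 2 = permRuns w % 2 := by
  induction h generalizing w' with
  | refl u =>
    obtain rfl : w = w' := Equiv.ext (congrFun (List.ofFn_injective (hu.symm.trans hv)))
    rfl
  | proper _ hm hB ih =>
    subst hv
    obtain ⟨w₁, rfl⟩ := KnuthPath.exists_oneLine_eq hm.perm
    have h1 := (properlyAdjacent_of_knuthMove hm hB).tailCount_zero_eq (initialState_injective _)
      (initialState_injective _)
    have h2 : permRuns w₁ = permRuns w' := h1
    rw [← h2]
    exact ih hu rfl
  | both _ hB ih =>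
    subst hv
    obtain ⟨w₁, rfl⟩ := KnuthPath.exists_oneLine_eq (KnuthMove.perm (Or.inl hB.1))
    have h1 := ih hu rfl
    have h2 := permRuns_of_knuthBoth hB
    omega

/-- Every intermediate word has a limit index of its own, and it is passed along the path one move
at a time. -/
theorem KnuthPath.isLimitIndex_eq {k : ℕ} {u v : List (Fin n)} (h : KnuthPath k u v) (hk : k = 0)
    (hu : u = oneLine w) (hv : v = oneLine w') {f f' : Fin n → ℕ} {T T' : ℕ}
    (hf : IsLimitIndex (initialState w) f T) (hf' : IsLimitIndex (initialState w') f' T') :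
    f = f' := by
  induction h generalizing w' f' T' with
  | refl u =>
    obtain rfl : w = w' := Equiv.ext (congrFun (List.ofFn_injective (hu.symm.trans hv)))
    exact hf.unique hf'
  | proper _ hm hB ih =>
    subst hv
    obtain ⟨w₁, rfl⟩ := KnuthPath.exists_oneLine_eq hm.perm
    obtain ⟨f₁, T₁, hf₁⟩ := exists_isLimitIndex (initialState_injective w₁)
    rw [ih hk hu rfl hf₁]
    exact (properlyAdjacent_of_knuthMove hm hB).isLimitIndex_eq (initialState_injective _)
      (initialState_injective _) hf₁ hf'
  | both _ _ _ => exact absurd hk (Nat.succ_ne_zero _)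

end KnuthPaths

/-- The tableau `S` is `SD(w)`: the first conjunct says that it exists and does not depend on the
steady state that is chosen. -/
theorem corollary7p2 (n : ℕ) (w : Equiv.Perm (Fin n)) (T : List (List (Fin n)))
    (r : List (Fin n)) (hT : T = insertionTableau (oneLine w)) (hr : r = rowReadingWord T) :
    ∃ S : List (List (Fin n)),
      (∀ S' : List (List (Fin n)), IsSolitonDecomposition w S' ↔ S' = S) ∧
      ((∃ k : ℕ, Odd k ∧ KnuthPath k r (oneLine w)) → S ≠ T) ∧
      (KnuthPath 0 r (oneLine w) → S = T) := by
  have hs := initialState_injective w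
  obtain ⟨f, t₀, hf⟩ := exists_isLimitIndex hs
  have hsteady : IsSteadyState (bbsState w t₀) := isSteadyState_of_isLimitIndex hs hf
  obtain ⟨hrow, hlen⟩ := isRowList_increasingRuns (bbsMove_iterate_injective hs t₀)
  rw [tailCount_zero_bbsMove_iterate hs] at hlen
  obtain ⟨htab, hperm⟩ := isTableau_insertionTableau (oneLine w)
  rw [← hT] at htab hperm
  obtain ⟨v, hv⟩ := exists_oneLine_eq
    (((rowReadingWord_perm T).trans hperm).trans (oneLine_perm w))
  obtain ⟨hvrow, hvlim⟩ := isLimitIndex_rowReadingWord htab hv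
  refine ⟨increasingRuns (bbsState w t₀), fun S' => ⟨?_, ?_⟩, ?_, ?_⟩
  · rintro ⟨t, ht, rfl⟩
    -- Both steady states evolve into the state at time `t + t₀` without changing their runs.
    have h1 := ht.1 t₀
    have h2 := hsteady.1 t
    rw [bbsState, ← Function.iterate_add_apply] at h1 h2
    rw [bbsState, bbsState, ← h1, ← h2, add_comm]
  · rintro rfl
    exact ⟨t₀, hsteady, rfl⟩
  · rintro ⟨k, hk, hpath⟩ hST
    -- The runs of `v` are the rows of `T`, and the runs of `w` are as many as the solitons. An odd
    -- number of `K_B` moves makes these numbers differ in parity.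
    have h1 := hpath.permRuns_parity (hr.trans hv.symm) rfl
    have h2 : (increasingRuns (initialState v)).length = permRuns v :=
      (isRowList_increasingRuns (initialState_injective v)).2
    rw [increasingRuns_initialState htab hv, ← hST] at h2
    have h3 : (increasingRuns (bbsState w t₀)).length = permRuns w := hlen
    rw [Nat.odd_iff] at hk
    omega
  · intro hpath
    have h1 := hpath.isLimitIndex_eq rfl (hr.trans hv.symm) rfl hvlim hf
    rw [hf t₀ le_rfl] at hrow
    rw [h1] at hvrow
    exact hrow.unique hvrow
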